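/- Conventions. A 3-CNF formula with $m$ clauses is a conjunction of $m$ clauses, each a disjunction of three (not necessarily distinct) literals, over $n\le 3m$ variables; it defines $f:\{0,1\}^n\to\{0,1\}$, and $\#f=\sum_{x\in\{0,1\}^n}f(x)$. A Clifford+T circuit on $N$ qubits is a finite sequence of gates $H$, $S=\mathrm{diag}(1,i)$, $CZ=\mathrm{diag}(1,1,1,-1)$ and $T=\mathrm{diag}(1,e^{i\pi/4})$ with unitary $V$; its acceptance probability is $p_{acc}=|\langle 0^N|V|0^N\rangle|^2$, and its size is $N$ plus the number of its gates. Algorithms are deterministic (multi-stack) Turing machines that get a description of the formula or circuit as input; indices of variables and qubits are written in unary and output numbers in binary. Exponential time hypothesis (ETH): for every deterministic algorithm that decides, given a 3-CNF formula $f$, whether $\#f>0$ or $\#f=0$, its running time is $2^{\Omega(m)}$ in the number $m$ of clauses, that is, there is $c>0$ such that for infinitely many $m$ the algorithm takes more than $2^{cm}$ steps on some formula with $m$ clauses. Theorem. Assume ETH. Then there is a polynomial $P$ such that for every deterministic algorithm $A$ and every function $g:\mathbb{N}\to\mathbb{R}$ with $g(t)=o(t)$ the following holds for infinitely many $t$: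 there is a Clifford+T circuit with exactly $t$ $T$ gates and of size at most $P(t)$ such that $A$, given a description of the circuit, does not output within $2^{g(t)}$ steps a nonnegative rational number $q$ (as a fraction of binary integers) with $$|p_{acc}-q|<2^{-\frac{3t+14}{7}}.$$ -/

import Mathlib

open Filter Asymptotics Turing

/-! ### Formulas in 3-CNF -/

/-- A literal over the variables `x_0, …, x_{n-1}`: the pair `(i, true)` is `x_i`, the pair
`(i, false)` is its negation. -/
abbrev Literal (n : ℕ) : Type := Fin n × Bool

/-- A formula in conjunctive normal form with three literals in each clause (a literal may be
repeated, so that shorter clauses are covered). There are at most three times as many variables as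
clauses, which is automatic if every variable occurs. -/
structure CNF3 where
  /-- number `n` of variables -/
  numVars : ℕ
  /-- the list of clauses -/
  clauses : List (Literal numVars × Literal numVars × Literal numVars)
  numVars_le : numVars ≤ 3 * clauses.length

namespace CNF3

/-- The number `m` of clauses. -/
def numClauses (φ : CNF3) : ℕ := φ.clauses.length

/-- Truth value of a literal under an assignment. -/
def evalLit {n : ℕ} (x : Fin n → Bool) (l : Literal n) : Bool :=
  if l.2 then x l.1 else !(x l.1)

/-- The Boolean function `f : {0,1}^n → {0,1}` described by the formula. -/
def eval (φ : CNF3) (x : Fin φ.numVars → Bool) : Bool :=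
  φ.clauses.all fun c => evalLit x c.1 || evalLit x c.2.1 || evalLit x c.2.2

/-- `#f = ∑_x f(x)`. -/
def count (φ : CNF3) : ℕ := ∑ x : Fin φ.numVars → Bool, (φ.eval x).toNat

/-- The symbols used to write down 3-CNF formulas. -/
inductive Symbol
  | tick
  | pos
  | neg
  deriving DecidableEq

/-- A literal is written as its sign followed by the index of its variable in unary. -/
def encodeLit {n : ℕ} (l : Literal n) : List Symbol :=
  (if l.2 then Symbol.pos else Symbol.neg) :: List.replicate l.1.val Symbol.tick

/-- The description of a formula: the number of variables in unary, then the literals of all the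
clauses in order. -/
def encode (φ : CNF3) : List Symbol :=
  List.replicate φ.numVars Symbol.tick ++
    φ.clauses.flatMap fun c => encodeLit c.1 ++ encodeLit c.2.1 ++ encodeLit c.2.2

end CNF3

/-! ### Algorithms and running time -/

/-- The deterministic multi-stack Turing machine `A` (with input alphabet `Γ₀` and output
alphabet `Γ₁`), started on the input `x`, halts with the output `y` after at most `T` steps. -/
def OutputsWithin {Γ₀ Γ₁ : Type} (A : TM2ComputableAux Γ₀ Γ₁) (x : List Γ₀) (y : List Γ₁)
    (T : ℝ) : Prop :=
  ∃ k : ℕ, (k : ℝ) ≤ T ∧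
    Nonempty (TM2OutputsInTime A.tm (x.map A.inputAlphabet.symm)
      (some (y.map A.outputAlphabet.symm)) k)

/-- The answer (one bit) to the question whether `#f > 0`. -/
def satAnswer (φ : CNF3) : List Bool := [decide (0 < φ.count)]

/-- `A` decides for every given 3-CNF formula `f` whether `#f > 0` or `#f = 0`. -/
def DecidesSat (A : TM2ComputableAux CNF3.Symbol Bool) : Prop :=
  ∀ φ : CNF3, ∃ T : ℝ, OutputsWithin A φ.encode (satAnswer φ) T

/-- The exponential time hypothesis: every deterministic algorithm that decides whether `#f > 0` or
`#f = 0` for a given 3-CNF formula `f` with `m` clauses needs time `2 ^ Ω(m)`, that is, for some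
`c > 0` it takes more than `2 ^ (c m)` steps on some formula with `m` clauses, for infinitely
many `m`. (Equivalently, there is no such algorithm with running time `2 ^ o(m)`.) -/
def ExponentialTimeHypothesis : Prop :=
  ∀ A : TM2ComputableAux CNF3.Symbol Bool, DecidesSat A →
    ∃ c : ℝ, 0 < c ∧ ∃ᶠ m : ℕ in atTop, ∃ φ : CNF3, φ.numClauses = m ∧
      ¬ OutputsWithin A φ.encode (satAnswer φ) ((2 : ℝ) ^ (c * (m : ℝ)))

/-! ### Clifford+T circuits -/

/-- Gates on `N` qubits: `H`, `S`, `T` on one qubit and `CZ` on two distinct qubits. -/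
inductive CTGate (N : ℕ)
  | H (i : Fin N)
  | S (i : Fin N)
  | T (i : Fin N)
  | CZ (i j : Fin N) (hij : i ≠ j)

/-- Operators on `N` qubits, as matrices in the computational basis. -/
abbrev QubitMatrix (N : ℕ) : Type := Matrix (Fin N → Bool) (Fin N → Bool) ℂ

/-- The one-qubit operator `u` applied to qubit `i`, tensored with the identity on the others. -/
noncomputable def onQubit {N : ℕ} (u : Bool → Bool → ℂ) (i : Fin N) : QubitMatrix N :=
  fun x y => if ∀ j, j ≠ i → x j = y j then u (x i) (y i) else 0

namespace CTGate

/-- The unitary matrix of a gate. -/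
noncomputable def matrix {N : ℕ} : CTGate N → QubitMatrix N
  | H i => onQubit (fun a b => (if a && b then -1 else 1) / (Real.sqrt 2 : ℂ)) i
  | S i => onQubit (fun a b => if a = b then (if a then Complex.I else 1) else 0) i
  | T i => onQubit
      (fun a b => if a = b then (if a then Complex.exp (Real.pi / 4 * Complex.I) else 1) else 0) i
  | CZ i j _ => Matrix.diagonal fun x => if x i && x j then -1 else 1

/-- Whether the gate is a `T` gate. -/
def isT {N : ℕ} : CTGate N → Bool
  | T _ => true
  | _ => false

/-- The symbols used to write down circuits. -/
inductive Symbol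
  | tick
  | sep
  | h
  | s
  | t
  | cz
  deriving DecidableEq

/-- A gate is written as its name followed by its qubits, each given by its index in unary. -/
def encode {N : ℕ} : CTGate N → List Symbol
  | H i => Symbol.h :: List.replicate i.val Symbol.tick
  | S i => Symbol.s :: List.replicate i.val Symbol.tick
  | T i => Symbol.t :: List.replicate i.val Symbol.tick
  | CZ i j _ =>
      Symbol.cz :: (List.replicate i.val Symbol.tick ++ Symbol.sep ::
        List.replicate j.val Symbol.tick)

end CTGate

/-- A Clifford+T circuit: a number of qubits and a list of gates, the first of which is applied
first. -/
structure CTCircuit where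
  /-- number `N` of qubits -/
  numQubits : ℕ
  /-- the gates, in the order in which they are applied -/
  gates : List (CTGate numQubits)

namespace CTCircuit

/-- The unitary of a list of gates, the first of which is applied first. -/
noncomputable def unitaryOf {N : ℕ} : List (CTGate N) → QubitMatrix N
  | [] => 1
  | g :: gs => unitaryOf gs * g.matrix

/-- The acceptance probability `|⟨0^N| V |0^N⟩|^2`. -/
noncomputable def pAcc (V : CTCircuit) : ℝ :=
  ‖unitaryOf V.gates (fun _ => false) (fun _ => false)‖ ^ 2

/-- The number of `T` gates. -/
def tCount (V : CTCircuit) : ℕ := V.gates.countP CTGate.isT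

/-- The size: number of qubits plus number of gates. -/
def size (V : CTCircuit) : ℕ := V.numQubits + V.gates.length

/-- The description of a circuit: the number of qubits in unary, then the gates in order. -/
def encode (V : CTCircuit) : List CTGate.Symbol :=
  List.replicate V.numQubits CTGate.Symbol.tick ++ V.gates.flatMap CTGate.encode

end CTCircuit

/-- The fraction `a / b` written in binary (least significant digit first, no superfluous zeros):
the digits of `a`, a separator, the digits of `b`. -/
def encodeFraction (a b : ℕ) : List (Option Bool) :=
  a.bits.map some ++ none :: b.bits.map some

/-- Given the circuit `V`, the algorithm `A` outputs within `T` steps a rational number (as a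
fraction) whose distance to the acceptance probability of `V` is smaller than `ε`. -/
def ComputesPAccWithin (A : TM2ComputableAux CTGate.Symbol (Option Bool)) (V : CTCircuit)
    (T ε : ℝ) : Prop :=
  ∃ a b : ℕ, 0 < b ∧ OutputsWithin A V.encode (encodeFraction a b) T ∧
    |V.pAcc - (a : ℝ) / (b : ℝ)| < ε

/-! ### Circuits acting on a work qubit, controlled by the sign basis of the other qubits -/

namespace CTCircuit

/-! Approximating acceptance probabilities to this precision decides satisfiability, so a fast `A`
would contradict ETH. A formula with `m` clauses becomes a circuit with `28m + 8p` T gates on a work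
qubit `0`, one qubit per variable and one flag qubit per clause.

The state `|0^M⟩` of the last `M` qubits is the average over sign patterns `z` of the products of
`|0⟩ ± |1⟩`. Each block of gates preserves such a product and acts on the work qubit by a 2×2 matrix
depending on `z`. So `⟨0|V|0⟩` is the average over `z` of a matrix entry
(`ActsAs.two_pow_mul_unitaryOf_apply`): the superposition over all assignments comes for free.

With `ω = e^{iπ/4}`, a clause with `k` true literals contributes, up to a phase independent of the
assignment, `(ω^k + ω^(4-k)) / 2`. This vanishes for `k = 0` and has modulus at least `√2/2`
otherwise (`exists_clausePhase_add`). The sign of the flag qubit multiplies the amplitude with which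
the work qubit leaves `|0⟩`, so that amplitude averages out and the work qubit is in effect
projected onto `|0⟩` after each clause (`exists_actsAs_formulaGates`). Hence `p_acc` is the square
of the average product of clause weights (`pAcc_ofFormula`): `0` for an unsatisfiable formula, at
least `2^(-9m)` for a satisfiable one. The permitted error is at most `2^(-(12m+2))`, so the binary
lengths of numerator and denominator already tell the cases apart
(`satAnswer_eq_of_abs_pAcc_sub_lt`).

If only finitely many `t` were hard, a fixed padding by `T^8 = 1` would move all formulas past them.
A multi-stack machine that writes the circuit, simulates `A` and compares lengths in unary
(`within_initial`) would then decide satisfiability in time `O(m²) + O(2^g(t))` with `t = 28m +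
O(1)`, which is below `2^(cm)` for every `c > 0` and all large `m`. -/

/-- The (unnormalized) state in which qubit `0` is in the basis state `b` and every other qubit is
in one of the states `|0⟩ ± |1⟩`, with signs given by `z`. -/
def signState {M : ℕ} (z : Fin M → Bool) (b : Bool) : (Fin (M + 1) → Bool) → ℂ :=
  fun y => if y 0 = b then ∏ j, (if z j && y j.succ then (-1 : ℂ) else 1) else 0

theorem onQubit_mulVec {N : ℕ} (u : Bool → Bool → ℂ) (i : Fin N) (v : (Fin N → Bool) → ℂ)
    (y : Fin N → Bool) :
    (onQubit u i).mulVec v y = ∑ b, u (y i) b * v (Function.update y i b) := by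
  classical
  have hinj : Set.InjOn (fun b : Bool => Function.update y i b) (Finset.univ : Finset Bool) :=
    fun a _ b _ h => by simpa using congrFun h i
  have himg : ∑ b, u (y i) b * v (Function.update y i b) =
      ∑ x ∈ Finset.univ.image (fun b : Bool => Function.update y i b), u (y i) (x i) * v x := by
    rw [Finset.sum_image hinj]
    simp
  rw [himg, Matrix.mulVec, dotProduct]
  symm
  rw [← Finset.sum_subset (Finset.subset_univ
    (Finset.univ.image (fun b : Bool => Function.update y i b)))]
  · refine Finset.sum_congr rfl fun x hx => ?_
    obtain ⟨b, -, rfl⟩ := Finset.mem_image.1 hx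
    simp only [onQubit]
    rw [if_pos]
    intro j hj
    simp [hj]
  · intro x _ hx
    simp only [onQubit]
    rw [if_neg, zero_mul]
    intro h
    refine hx (Finset.mem_image.2 ⟨x i, Finset.mem_univ _, ?_⟩)
    ext j
    by_cases hj : j = i
    · subst hj; simp
    · simp [hj, h j hj]

theorem unitaryOf_append {N : ℕ} (gs hs : List (CTGate N)) :
    unitaryOf (gs ++ hs) = unitaryOf hs * unitaryOf gs := by
  induction gs with
  | nil => simp [unitaryOf]
  | cons g gs ih => simp [unitaryOf, ih, mul_assoc]

theorem unitaryOf_singleton {N : ℕ} (g : CTGate N) : unitaryOf [g] = g.matrix := by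
  simp [unitaryOf]

/-- The gates act on the work qubit `0` by the matrix `F z` when the signs of the other qubits
are `z`. -/
def ActsAs {M : ℕ} (gs : List (CTGate (M + 1))) (F : (Fin M → Bool) → Matrix Bool Bool ℂ) : Prop :=
  ∀ z b, (unitaryOf gs).mulVec (signState z b) = ∑ a, F z a b • signState z a

namespace ActsAs

variable {M : ℕ}

theorem nil : ActsAs ([] : List (CTGate (M + 1))) (fun _ => 1) := by
  intro z b
  simp [unitaryOf, Matrix.one_apply]

theorem append {gs hs : List (CTGate (M + 1))} {F G : (Fin M → Bool) → Matrix Bool Bool ℂ}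
    (hF : ActsAs gs F) (hG : ActsAs hs G) : ActsAs (gs ++ hs) (fun z => G z * F z) := by
  intro z b
  rw [unitaryOf_append, ← Matrix.mulVec_mulVec, hF z b, Matrix.mulVec_sum]
  simp_rw [Matrix.mulVec_smul, hG z, Finset.smul_sum, smul_smul]
  rw [Finset.sum_comm]
  simp_rw [← Finset.sum_smul, Matrix.mul_apply, mul_comm]

theorem of_onQubit {g : CTGate (M + 1)} (u : Bool → Bool → ℂ) (hg : g.matrix = onQubit u 0) :
    ActsAs [g] (fun _ => Matrix.of u) := by
  intro z b
  ext y
  rw [unitaryOf_singleton, hg, onQubit_mulVec]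
  simp only [signState, Finset.sum_apply, Pi.smul_apply, smul_eq_mul, Function.update_self,
    Matrix.of_apply, Fintype.sum_bool, ne_eq, Fin.succ_ne_zero, not_false_eq_true, Function.update_of_ne]
  cases b <;> cases y 0 <;> simp

end ActsAs

/-! ### One-qubit matrices and eighth roots of unity -/

/-- The Hadamard matrix. -/
noncomputable def hadamard : Matrix Bool Bool ℂ :=
  fun a b => (if a && b then -1 else 1) / (Real.sqrt 2 : ℂ)

/-- A diagonal one-qubit matrix `diag(1, c)`. -/
def phase (c : ℂ) : Matrix Bool Bool ℂ := Matrix.diagonal fun a => if a then c else 1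

/-- The primitive eighth root of unity `e^{iπ/4}`. -/
noncomputable def omega : ℂ := Complex.exp (Real.pi / 4 * Complex.I)

theorem omega_sq : omega ^ 2 = Complex.I := by
  rw [omega, ← Complex.exp_nat_mul,
    show ((2 : ℕ) : ℂ) * (Real.pi / 4 * Complex.I) = Real.pi / 2 * Complex.I by push_cast; ring,
    Complex.exp_pi_div_two_mul_I]

theorem omega_pow_eight : omega ^ 8 = 1 := by
  calc omega ^ 8 = (omega ^ 2) ^ 4 := by ring
    _ = 1 := by rw [omega_sq, Complex.I_pow_four]

theorem norm_omega : ‖omega‖ = 1 := by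
  have := Complex.norm_exp_ofReal_mul_I (Real.pi / 4)
  rw [omega]
  push_cast at this
  exact this

theorem omega_add_omega_pow_three : omega + omega ^ 3 = Real.sqrt 2 * Complex.I := by
  have h : omega = Real.sqrt 2 / 2 + Real.sqrt 2 / 2 * Complex.I := by
    rw [omega, Complex.exp_mul_I]
    have h1 := Real.cos_pi_div_four
    have h2 := Real.sin_pi_div_four
    rw [show (Real.pi / 4 : ℂ) = ((Real.pi / 4 : ℝ) : ℂ) by push_cast; rfl, ← Complex.ofReal_cos,
      ← Complex.ofReal_sin, h1, h2]
    push_cast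
    rfl
  rw [pow_succ, omega_sq, h]
  linear_combination (Real.sqrt 2 / 2 : ℂ) * Complex.I_sq

theorem sqrt_two_mul_self : (Real.sqrt 2 : ℂ) * Real.sqrt 2 = 2 := by
  rw [← Complex.ofReal_mul, Real.mul_self_sqrt (by norm_num)]
  norm_num

theorem inv_sqrt_two_sq : ((Real.sqrt 2 : ℂ)⁻¹) ^ 2 = 1 / 2 := by
  rw [inv_pow, pow_two, sqrt_two_mul_self, one_div]

theorem phase_one : phase 1 = 1 := by simp [phase]

theorem phase_mul (c d : ℂ) : phase c * phase d = phase (c * d) := by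
  simp only [phase, Matrix.diagonal_mul_diagonal]
  congr 1
  ext a
  cases a <;> simp

namespace ActsAs

variable {M : ℕ}

theorem hadamard : ActsAs [(CTGate.H 0 : CTGate (M + 1))] (fun _ => CTCircuit.hadamard) :=
  of_onQubit (fun a b => (if a && b then -1 else 1) / (Real.sqrt 2 : ℂ)) rfl

theorem tGate : ActsAs [(CTGate.T 0 : CTGate (M + 1))] (fun _ => phase omega) := by
  have h := of_onQubit (g := (CTGate.T 0 : CTGate (M + 1)))
    (fun a b => if a = b then (if a then omega else 1) else 0) rfl
  exact h

theorem sGate : ActsAs [(CTGate.S 0 : CTGate (M + 1))] (fun _ => phase Complex.I) := by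
  have h := of_onQubit (g := (CTGate.S 0 : CTGate (M + 1)))
    (fun a b => if a = b then (if a then Complex.I else 1) else 0) rfl
  exact h

theorem replicate_phase {g : CTGate (M + 1)} {c : ℂ} (h : ActsAs [g] (fun _ => phase c)) (k : ℕ) :
    ActsAs (List.replicate k g) (fun _ => phase (c ^ k)) := by
  induction k with
  | zero => simpa [phase_one] using nil
  | succ k ih =>
    have := h.append ih
    simpa [phase_mul, List.replicate_succ, pow_succ] using this

end ActsAs

/-! ### Coupling the work qubit to a sign -/

/-- The gates `H CZ H` that multiply the work qubit by `Z` if qubit `j + 1` has sign `-`. -/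
def coupling {M : ℕ} (j : Fin M) : List (CTGate (M + 1)) :=
  [CTGate.H j.succ, CTGate.CZ j.succ 0 (Fin.succ_ne_zero j), CTGate.H j.succ]

/-- Isolates the tensor factor at qubit `j + 1`; the scalar `r` collects the other factors,
including the condition on qubit `0`. This reduces `coupling` to a computation on two qubits. -/
theorem signState_update {M : ℕ} (z : Fin M → Bool) (b : Bool) (j : Fin M)
    (y : Fin (M + 1) → Bool) :
    ∃ r : ℂ, (y 0 ≠ b → r = 0) ∧ ∀ d, signState z b (Function.update y j.succ d) =
      r * (if z j && d then (-1 : ℂ) else 1) := by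
  refine ⟨if y 0 = b then ∏ i ∈ Finset.univ.erase j,
    (if z i && y i.succ then (-1 : ℂ) else 1) else 0, fun h => if_neg h, fun d => ?_⟩
  have h0 : Function.update y j.succ d 0 = y 0 :=
    Function.update_of_ne (Fin.succ_ne_zero j).symm _ _
  simp only [signState, h0]
  by_cases h : y 0 = b
  · rw [if_pos h, if_pos h, ← Finset.prod_erase_mul _ _ (Finset.mem_univ j)]
    congr 1
    · refine Finset.prod_congr rfl fun i hi => ?_
      rw [Function.update_of_ne]
      simpa using (Finset.mem_erase.1 hi).1
    · simp
  · simp only [if_neg h, zero_mul]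

/-- The first `H` turns `|0⟩ ± |1⟩` into a multiple of the basis state recording the sign, `CZ` then
applies `Z` or nothing to the work qubit, and the last `H` restores the sign state. -/
theorem actsAs_coupling {M : ℕ} (j : Fin M) :
    ActsAs (coupling j) (fun z => phase (if z j then -1 else 1)) := by
  intro z b
  ext y
  obtain ⟨r, hr, h⟩ := signState_update z b j y
  have hself := h (y j.succ)
  rw [Function.update_eq_self] at hself
  have hsum : (∑ a, phase (if z j then -1 else 1) a b • signState z a) y =
      (if b then (if z j then -1 else 1) else 1) * signState z b y := by
    simp only [Finset.sum_apply, Pi.smul_apply, smul_eq_mul, Fintype.sum_bool, phase]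
    cases b <;> simp
  rw [hsum, coupling]
  simp only [unitaryOf, one_mul, ← Matrix.mulVec_mulVec]
  have h0 : ∀ c, Function.update y j.succ c 0 = y 0 := fun c =>
    Function.update_of_ne (Fin.succ_ne_zero j).symm _ _
  simp only [CTGate.matrix, onQubit_mulVec, Matrix.mulVec_diagonal, Fintype.sum_bool,
    Function.update_idem, h, hself, h0, Function.update_self]
  by_cases hb : y 0 = b
  · subst hb
    have key := inv_sqrt_two_sq
    cases z j <;> cases y 0 <;> cases y j.succ <;> simp [div_eq_mul_inv] <;> ring_nf <;>
      simp [key] <;> ring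
  · simp [hr hb]

end CTCircuit

/-! ### The circuit of a formula -/

namespace CTCircuit

/-- Multiplies the work qubit, in the Hadamard basis, by a phase depending on a literal. -/
def literalGates {M : ℕ} (neg : Bool) (j : Fin M) : List (CTGate (M + 1)) :=
  [CTGate.H 0] ++ coupling j ++ [CTGate.H 0] ++ List.replicate 9 (CTGate.T 0) ++
    List.replicate (if neg then 3 else 0) (CTGate.S 0) ++ [CTGate.H 0] ++ coupling j ++ [CTGate.H 0]

/-- The diagonal phase applied by `literalGates`. -/
noncomputable def literalPhase (neg x a : Bool) : ℂ :=
  if a ^^ x then (if neg then omega ^ 7 else omega) else 1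

/-- `HZH = X`, so a coupling between two Hadamards on the work qubit is a NOT controlled by the
sign. -/
theorem hadamard_mul_phase_mul_hadamard (b : Bool) :
    hadamard * (phase (if b then -1 else 1) * hadamard) =
      Matrix.of fun a a' => if (a ^^ a') = b then (1 : ℂ) else 0 := by
  have h := sqrt_two_mul_self
  ext a a'
  cases a <;> cases a' <;> cases b <;>
    simp [hadamard, phase, Matrix.mul_apply, div_eq_mul_inv, ← mul_inv, h] <;> norm_num

/-- Conjugating `diag(1, c)` by `X` to the power `z j` moves the phase `c` to the branch of the work
qubit that differs from `z j`. -/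
theorem actsAs_literalGates {M : ℕ} (neg : Bool) (j : Fin M) :
    ActsAs (literalGates neg j) (fun z => Matrix.diagonal (literalPhase neg (z j))) := by
  have h := ((((((ActsAs.hadamard (M := M)).append (actsAs_coupling j)).append
    ActsAs.hadamard).append (ActsAs.tGate.replicate_phase 9)).append
    (ActsAs.sGate.replicate_phase (if neg then 3 else 0))).append ActsAs.hadamard).append
      (actsAs_coupling j) |>.append ActsAs.hadamard
  have h' : ActsAs (literalGates neg j) _ := h
  convert h' using 1
  ext1 z
  -- One T gate would give the same matrix. The other eight serve only to raise the T-count to `1 +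
  -- 3 * 9 = 28` per clause, which makes the permitted error small enough for the gap `2^(-9m)`.
  have h9 : omega ^ 9 = omega := by
    rw [show 9 = 8 + 1 from rfl, pow_succ, omega_pow_eight, one_mul]
  have hneg : Complex.I ^ (if neg then 3 else 0) * omega = if neg then omega ^ 7 else omega := by
    cases neg
    · simp
    · simp only [if_true]
      rw [← omega_sq]
      ring
  rw [hadamard_mul_phase_mul_hadamard, ← mul_assoc (phase (Complex.I ^ _)), phase_mul, h9, hneg,
    ← mul_assoc (phase (if z j then -1 else 1)), ← mul_assoc CTCircuit.hadamard,
    hadamard_mul_phase_mul_hadamard]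
  unfold literalPhase
  generalize (if neg then omega ^ 7 else omega) = c
  ext a a'
  cases a <;> cases a' <;> cases z j <;> simp [phase, Matrix.mul_apply, Matrix.diagonal_apply]

/-- The gates for a clause with literals on the qubits `i₁ + 1`, `i₂ + 1`, `i₃ + 1`; the qubit
`f + 1` flags that the clause is violated. -/
def clauseGates {M n : ℕ} (e : Fin n → Fin M) (c : Literal n × Literal n × Literal n) (f : Fin M) :
    List (CTGate (M + 1)) :=
  [CTGate.H 0, CTGate.T 0] ++ literalGates (!c.1.2) (e c.1.1) ++
    literalGates (!c.2.1.2) (e c.2.1.1) ++ literalGates (!c.2.2.2) (e c.2.2.1) ++ [CTGate.H 0] ++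
    coupling f

/-- The amplitude contributed by a clause, up to a phase. -/
noncomputable def clauseWeight {n : ℕ} (c : Literal n × Literal n × Literal n) (x : Fin n → Bool) :
    ℝ :=
  match CNF3.evalLit x c.1, CNF3.evalLit x c.2.1, CNF3.evalLit x c.2.2 with
  | false, false, false => 0
  | true, true, false => 1
  | true, false, true => 1
  | false, true, true => 1
  | _, _, _ => Real.sqrt 2 / 2

theorem clauseWeight_eq_zero {n : ℕ} (c : Literal n × Literal n × Literal n) (x : Fin n → Bool)
    (h : (CNF3.evalLit x c.1 || CNF3.evalLit x c.2.1 || CNF3.evalLit x c.2.2) = false) :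
    clauseWeight c x = 0 := by
  unfold clauseWeight
  revert h
  cases CNF3.evalLit x c.1 <;> cases CNF3.evalLit x c.2.1 <;> cases CNF3.evalLit x c.2.2 <;> simp

theorem clauseWeight_nonneg {n : ℕ} (c : Literal n × Literal n × Literal n) (x : Fin n → Bool) :
    0 ≤ clauseWeight c x := by
  unfold clauseWeight
  cases CNF3.evalLit x c.1 <;> cases CNF3.evalLit x c.2.1 <;> cases CNF3.evalLit x c.2.2 <;>
    simp <;> positivity

theorem le_clauseWeight {n : ℕ} (c : Literal n × Literal n × Literal n) (x : Fin n → Bool)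
    (h : (CNF3.evalLit x c.1 || CNF3.evalLit x c.2.1 || CNF3.evalLit x c.2.2) = true) :
    Real.sqrt 2 / 2 ≤ clauseWeight c x := by
  have h2 : Real.sqrt 2 / 2 ≤ 1 := by
    rw [div_le_one (by norm_num), Real.sqrt_le_left (by norm_num)]
    norm_num
  unfold clauseWeight
  revert h
  cases CNF3.evalLit x c.1 <;> cases CNF3.evalLit x c.2.1 <;> cases CNF3.evalLit x c.2.2 <;>
    simp [h2]

/-- The diagonal phase applied by all the literals of a clause. -/
noncomputable def clausePhase {n : ℕ} (c : Literal n × Literal n × Literal n) (x : Fin n → Bool)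
    (a : Bool) : ℂ :=
  literalPhase (!c.2.2.2) (x c.2.2.1) a * (literalPhase (!c.2.1.2) (x c.2.1.1) a *
    (literalPhase (!c.1.2) (x c.1.1) a * if a then omega else 1))

/-- Since `ω^7 = ω⁻¹`, negating a literal is the same as complementing its truth value, up to a
factor that depends on neither the branch nor the assignment. -/
theorem literalPhase_eq {n : ℕ} (l : Literal n) (x : Fin n → Bool) (a : Bool) :
    literalPhase (!l.2) (x l.1) a =
      (if l.2 then 1 else omega ^ 7) * (if a ^^ CNF3.evalLit x l then omega else 1) := by
  have h8 := omega_pow_eight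
  have h8' : omega ^ 7 * omega = 1 := by rw [← pow_succ, h8]
  unfold literalPhase CNF3.evalLit
  cases l.2 <;> cases a <;> cases x l.1 <;> simp [h8']

/-- With `k` true literals, branch `0` of the work qubit collects `ω^k` and branch `1` collects
`ω^(3-k)`, times `ω` from the additional T gate. The sum `ω^k + ω^(4-k)` is `0`, `√2 i`, `2i`, `√2
i` for `k = 0, 1, 2, 3`. The common phase `u` consists of `i` and a factor `ω^7` for each negative
literal. -/
theorem exists_clausePhase_add {n : ℕ} (c : Literal n × Literal n × Literal n) :
    ∃ u : ℂ, ‖u‖ = 1 ∧ ∀ x, (clausePhase c x false + clausePhase c x true) / 2 =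
      u * clauseWeight c x := by
  refine ⟨(if c.1.2 then 1 else omega ^ 7) * (if c.2.1.2 then 1 else omega ^ 7) *
    (if c.2.2.2 then 1 else omega ^ 7) * Complex.I, ?_, fun x => ?_⟩
  · have (b : Bool) : ‖(if b then 1 else omega ^ 7 : ℂ)‖ = 1 := by
      cases b <;> simp [norm_omega]
    simp only [norm_mul, this, Complex.norm_I, one_mul]
  · unfold clausePhase clauseWeight
    simp only [literalPhase_eq]
    generalize (if c.1.2 then 1 else omega ^ 7 : ℂ) = u₁
    generalize (if c.2.1.2 then 1 else omega ^ 7 : ℂ) = u₂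
    generalize (if c.2.2.2 then 1 else omega ^ 7 : ℂ) = u₃
    have h2 := omega_sq
    have h3 := omega_add_omega_pow_three
    have h4 : omega ^ 4 = -1 := by
      calc omega ^ 4 = (omega ^ 2) ^ 2 := by ring
        _ = -1 := by rw [h2, Complex.I_sq]
    cases CNF3.evalLit x c.1 <;> cases CNF3.evalLit x c.2.1 <;> cases CNF3.evalLit x c.2.2 <;>
      simp
    · linear_combination (u₁ * u₂ * u₃) * h4
    · linear_combination (u₁ * u₂ * u₃ / 2) * h3
    · linear_combination (u₁ * u₂ * u₃ / 2) * h3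
    · linear_combination (u₁ * u₂ * u₃) * h2
    · linear_combination (u₁ * u₂ * u₃ / 2) * h3
    · linear_combination (u₁ * u₂ * u₃) * h2
    · linear_combination (u₁ * u₂ * u₃) * h2
    · linear_combination (u₁ * u₂ * u₃ / 2) * h3

/-- The action of `clauseGates` on the work qubit. -/
noncomputable def clauseMatrix {n : ℕ} (c : Literal n × Literal n × Literal n) (x : Fin n → Bool)
    (f : Bool) : Matrix Bool Bool ℂ :=
  phase (if f then -1 else 1) * (hadamard * Matrix.diagonal (clausePhase c x) * hadamard)

theorem actsAs_clauseGates {M n : ℕ} (e : Fin n → Fin M) (c : Literal n × Literal n × Literal n)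
    (f : Fin M) :
    ActsAs (clauseGates e c f) (fun z => clauseMatrix c (z ∘ e) (z f)) := by
  have h := (((((((ActsAs.hadamard (M := M)).append ActsAs.tGate).append
    (actsAs_literalGates (!c.1.2) (e c.1.1))).append
    (actsAs_literalGates (!c.2.1.2) (e c.2.1.1))).append
    (actsAs_literalGates (!c.2.2.2) (e c.2.2.1))).append ActsAs.hadamard)).append
      (actsAs_coupling f)
  have h' : ActsAs (clauseGates e c f) _ := h
  convert h' using 1
  ext1 z
  have hd : Matrix.diagonal (clausePhase c (z ∘ e)) =
      Matrix.diagonal (literalPhase (!c.2.2.2) (z (e c.2.2.1))) *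
      (Matrix.diagonal (literalPhase (!c.2.1.2) (z (e c.2.1.1))) *
      (Matrix.diagonal (literalPhase (!c.1.2) (z (e c.1.1))) * phase omega)) := by
    simp only [phase, Matrix.diagonal_mul_diagonal]
    rfl
  rw [clauseMatrix, hd]
  simp only [mul_assoc]

theorem clauseMatrix_apply_false {n : ℕ} (c : Literal n × Literal n × Literal n)
    (x : Fin n → Bool) (f : Bool) :
    clauseMatrix c x f false false = (clausePhase c x false + clausePhase c x true) / 2 := by
  have key := inv_sqrt_two_sq
  simp [clauseMatrix, hadamard, phase, Matrix.mul_apply, div_eq_mul_inv, Matrix.diagonal_apply]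
  linear_combination (clausePhase c x false + clausePhase c x true) * key

theorem clauseMatrix_apply_true {n : ℕ} (c : Literal n × Literal n × Literal n)
    (x : Fin n → Bool) (f : Bool) :
    clauseMatrix c x (!f) true false = -clauseMatrix c x f true false := by
  cases f <;> simp [clauseMatrix, phase, Matrix.mul_apply, Matrix.diagonal_apply]

/-! ### Multiplying clause weights and averaging over signs -/

/-- The gates for a list of clauses, with flag qubits `k + 1, k + 2, …`. -/
def formulaGates {M n : ℕ} (e : Fin n → Fin M) :
    ∀ (cs : List (Literal n × Literal n × Literal n)) (k : ℕ), k + cs.length ≤ M →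
      List (CTGate (M + 1))
  | [], _, _ => []
  | c :: cs, k, h => clauseGates e c ⟨k, by simp at h; omega⟩ ++
      formulaGates e cs (k + 1) (by simp at h; omega)

/-- Flip one bit of an assignment. -/
def flip {M : ℕ} (j : Fin M) (z : Fin M → Bool) : Fin M → Bool := Function.update z j (!z j)

theorem flip_involutive {M : ℕ} (j : Fin M) : Function.Involutive (flip j) := by
  intro z
  simp [flip]

theorem flip_of_ne {M : ℕ} {j i : Fin M} (h : i ≠ j) (z : Fin M → Bool) : flip j z i = z i :=
  Function.update_of_ne h _ _

theorem sum_eq_zero_of_flip {M : ℕ} (j : Fin M) (F : (Fin M → Bool) → ℂ)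
    (h : ∀ z, F (flip j z) = -F z) : ∑ z, F z = 0 := by
  have h1 : ∑ z, F (flip j z) = ∑ z, F z :=
    Equiv.sum_comp (flip_involutive j).toPerm F
  simp_rw [h, Finset.sum_neg_distrib] at h1
  linear_combination (-1 / 2 : ℂ) * h1

/-- Induction on the clauses with a test function `s`, which absorbs the weights of the clauses
already treated. The invariance of `F` says that the remaining gates ignore the flags of earlier
clauses; this is what lets the sign of such a flag cancel. -/
theorem exists_actsAs_formulaGates {M n : ℕ} (e : Fin n → Fin M)
    (cs : List (Literal n × Literal n × Literal n)) (k : ℕ) (hk : k + cs.length ≤ M)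
    (he : ∀ i, (e i).val < k) :
    ∃ F, ActsAs (formulaGates e cs k hk) F ∧
      (∀ j : Fin M, j.val < k → (∀ i, e i ≠ j) → ∀ z, F (flip j z) = F z) ∧
      ∃ u : ℂ, ‖u‖ = 1 ∧ ∀ s : (Fin M → Bool) → ℂ,
        (∀ j : Fin M, k ≤ j.val → ∀ z, s (flip j z) = s z) →
        ∑ z, F z false false * s z =
          u * ∑ z, ((cs.map fun c => clauseWeight c (z ∘ e)).prod : ℝ) * s z := by
  induction cs generalizing k with
  | nil => exact ⟨fun _ => 1, ActsAs.nil, fun _ _ _ _ => rfl, 1, by simp, by simp⟩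
  | cons c cs ih =>
    have hk' : k + 1 + cs.length ≤ M := by simp at hk; omega
    have hkM : k < M := by omega
    obtain ⟨F, hF, hinv, u, hu, hs⟩ := ih (k + 1) hk' fun i => (he i).trans (Nat.lt_succ_self k)
    obtain ⟨v, hv, hc⟩ := exists_clausePhase_add c
    have hcomp (j : Fin M) (h : ∀ i, e i ≠ j) (z : Fin M → Bool) : flip j z ∘ e = z ∘ e := by
      ext i
      exact flip_of_ne (h i) z
    have hne (j : Fin M) (h : k ≤ j.val) (i : Fin n) : e i ≠ j := by
      rintro rfl
      exact absurd (he i) (not_lt.2 h)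
    refine ⟨fun z => F z * clauseMatrix c (z ∘ e) (z ⟨k, hkM⟩),
      (actsAs_clauseGates e c ⟨k, hkM⟩).append hF, fun j hj hje z => ?_, u * v,
      by simp [hu, hv], fun s hinvs => ?_⟩
    · beta_reduce
      rw [hinv j (hj.trans (Nat.lt_succ_self k)) hje, hcomp j hje,
        flip_of_ne fun h => hj.ne (congrArg Fin.val h).symm]
    -- The path through `|1⟩` is odd in the sign of flag `k`, while `F`, the literals and `s` do not
    -- depend on it.
    · have hodd : ∑ z, F z false true *
          (clauseMatrix c (z ∘ e) (z ⟨k, hkM⟩) true false * s z) = 0 := by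
        refine sum_eq_zero_of_flip ⟨k, hkM⟩ _ fun z => ?_
        rw [hinv _ (Nat.lt_succ_self k) (hne _ le_rfl), hcomp _ (hne _ le_rfl), hinvs _ le_rfl,
          show flip ⟨k, hkM⟩ z ⟨k, hkM⟩ = !z ⟨k, hkM⟩ by simp [flip], clauseMatrix_apply_true]
        ring
      -- The path through `|0⟩` remains; its weight depends on variable qubits only, so it may join
      -- the test function.
      have hmain := hs (fun z => (clauseWeight c (z ∘ e) : ℝ) * s z) fun j hj z => by
        rw [hcomp j (hne j (Nat.le_of_succ_le hj)), hinvs j (Nat.le_of_succ_le hj)]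
      calc ∑ z, (F z * clauseMatrix c (z ∘ e) (z ⟨k, hkM⟩)) false false * s z
          = v * ∑ z, F z false false * ((clauseWeight c (z ∘ e) : ℝ) * s z) := by
            rw [← sub_eq_zero, ← hodd, Finset.mul_sum, ← Finset.sum_sub_distrib]
            refine Finset.sum_congr rfl fun z _ => ?_
            rw [Matrix.mul_apply, Fintype.sum_bool, clauseMatrix_apply_false, hc]
            ring
        _ = _ := by
            rw [hmain, mul_comm u v, mul_assoc, Finset.mul_sum, Finset.mul_sum, Finset.mul_sum,
              Finset.mul_sum]
            refine Finset.sum_congr rfl fun z _ => ?_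
            rw [List.map_cons, List.prod_cons]
            push_cast
            ring

/-- The sum factors over the qubits, and `(|0⟩ + |1⟩) + (|0⟩ - |1⟩) = 2|0⟩`. -/
theorem sum_signState {M : ℕ} :
    ∑ z, signState (M := M) z false = (2 : ℂ) ^ M • Pi.single (fun _ => false) 1 := by
  ext y
  simp only [signState, Finset.sum_apply, Pi.smul_apply, smul_eq_mul]
  by_cases h0 : y 0 = false
  · simp only [h0, if_true]
    have hprod := Finset.prod_univ_sum (fun _ : Fin M => (Finset.univ : Finset Bool))
      (fun j b => if b && y j.succ then (-1 : ℂ) else 1)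
    rw [Fintype.piFinset_univ] at hprod
    rw [← hprod]
    by_cases hy : y = fun _ => false
    · subst hy
      simp [one_add_one_eq_two]
    · rw [Pi.single_eq_of_ne hy, mul_zero]
      obtain ⟨i, hi⟩ := Function.ne_iff.1 hy
      obtain ⟨j, rfl⟩ : ∃ j : Fin M, i = j.succ :=
        ⟨i.pred (by rintro rfl; exact hi h0), by simp⟩
      refine Finset.prod_eq_zero (Finset.mem_univ j) ?_
      simp at hi
      simp [hi]
  · rw [Pi.single_eq_of_ne (by rintro rfl; exact h0 rfl)]
    simp [h0]

/-- Apply the gates to `sum_signState` and read off the entry at `0`, where each sign state with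
work qubit `|0⟩` has coefficient `1`. -/
theorem ActsAs.two_pow_mul_unitaryOf_apply {M : ℕ} {gs : List (CTGate (M + 1))}
    {F : (Fin M → Bool) → Matrix Bool Bool ℂ} (h : ActsAs gs F) :
    2 ^ M * unitaryOf gs (fun _ => false) (fun _ => false) = ∑ z, F z false false := by
  have h1 := congrArg (fun v => (unitaryOf gs).mulVec v (fun _ => false)) (sum_signState (M := M))
  simp only [Matrix.mulVec_sum, Matrix.mulVec_smul, h _ false] at h1
  simp only [Matrix.mulVec_single_one, Pi.smul_apply, Matrix.col_apply, smul_eq_mul,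
    Finset.sum_apply] at h1
  rw [← h1]
  simp [signState]

/-- The circuit of a formula, with `8 p` additional `T` gates. -/
def ofFormula (φ : CNF3) (p : ℕ) : CTCircuit where
  numQubits := φ.numVars + φ.clauses.length + 1
  gates := formulaGates (Fin.castAdd φ.clauses.length) φ.clauses φ.numVars le_rfl ++
    List.replicate (8 * p) (CTGate.T 0)

theorem pAcc_ofFormula (φ : CNF3) (p : ℕ) :
    (ofFormula φ p).pAcc = ((∑ z : Fin (φ.numVars + φ.clauses.length) → Bool,
      (φ.clauses.map fun c => clauseWeight c (z ∘ Fin.castAdd φ.clauses.length)).prod) /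
        2 ^ (φ.numVars + φ.clauses.length)) ^ 2 := by
  obtain ⟨F, hF, -, u, hu, hs⟩ := exists_actsAs_formulaGates
    (Fin.castAdd φ.clauses.length) φ.clauses φ.numVars le_rfl fun i => i.isLt
  have hpad := (ActsAs.tGate (M := φ.numVars + φ.clauses.length)).replicate_phase (8 * p)
  rw [pow_mul, omega_pow_eight, one_pow, phase_one] at hpad
  have h := (hF.append hpad).two_pow_mul_unitaryOf_apply
  have h1 := hs (fun _ => 1) fun _ _ _ => rfl
  simp only [one_mul, mul_one] at h h1
  rw [h1, ← Complex.ofReal_sum] at h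
  have hnorm := congrArg norm h
  rw [norm_mul, norm_mul, hu, one_mul, Complex.norm_real, norm_pow, Complex.norm_ofNat,
    Real.norm_of_nonneg (Finset.sum_nonneg fun z _ => List.prod_nonneg ?_)] at hnorm
  · rw [← hnorm, mul_div_cancel_left₀ _ (by positivity)]
    rfl
  · intro r hr
    obtain ⟨c, -, rfl⟩ := List.mem_map.1 hr
    exact clauseWeight_nonneg c _

end CTCircuit

namespace CNF3

theorem count_pos_iff (φ : CNF3) : 0 < φ.count ↔ ∃ x, φ.eval x = true := by
  simp [count, Finset.sum_pos_iff, Nat.pos_iff_ne_zero]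

end CNF3

/-! ### T-count, size and the gap in the acceptance probability -/

namespace CTCircuit

theorem countP_isT_coupling {M : ℕ} (j : Fin M) : (coupling j).countP CTGate.isT = 0 := by
  simp [coupling, CTGate.isT]

theorem countP_isT_literalGates {M : ℕ} (neg : Bool) (j : Fin M) :
    (literalGates neg j).countP CTGate.isT = 9 := by
  simp only [literalGates, List.countP_append, countP_isT_coupling, List.countP_replicate]
  simp [CTGate.isT]

theorem length_literalGates_le {M : ℕ} (neg : Bool) (j : Fin M) :
    (literalGates neg j).length ≤ 22 := by
  cases neg <;> simp [literalGates, coupling]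

theorem countP_isT_formulaGates {M n : ℕ} (e : Fin n → Fin M)
    (cs : List (Literal n × Literal n × Literal n)) (k : ℕ) (hk : k + cs.length ≤ M) :
    (formulaGates e cs k hk).countP CTGate.isT = 28 * cs.length := by
  induction cs generalizing k with
  | nil => rfl
  | cons c cs ih =>
    simp only [formulaGates, clauseGates, List.countP_append, ih, countP_isT_literalGates,
      countP_isT_coupling, List.length_cons]
    simp [CTGate.isT]
    ring

theorem length_formulaGates_le {M n : ℕ} (e : Fin n → Fin M)
    (cs : List (Literal n × Literal n × Literal n)) (k : ℕ) (hk : k + cs.length ≤ M) :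
    (formulaGates e cs k hk).length ≤ 72 * cs.length := by
  induction cs generalizing k with
  | nil => simp [formulaGates]
  | cons c cs ih =>
    have h1 := length_literalGates_le (!c.1.2) (e c.1.1)
    have h2 := length_literalGates_le (!c.2.1.2) (e c.2.1.1)
    have h3 := length_literalGates_le (!c.2.2.2) (e c.2.2.1)
    have h4 := ih (k + 1) (by simp at hk; omega)
    simp only [formulaGates, clauseGates, List.length_append, List.length_cons, coupling,
      List.length_nil]
    omega

theorem tCount_ofFormula (φ : CNF3) (p : ℕ) :
    (ofFormula φ p).tCount = 28 * φ.numClauses + 8 * p := by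
  simp [tCount, ofFormula, countP_isT_formulaGates, List.countP_replicate, CTGate.isT,
    CNF3.numClauses]

theorem size_ofFormula_le (φ : CNF3) (p : ℕ) :
    (ofFormula φ p).size ≤ 3 * (ofFormula φ p).tCount + 1 := by
  have h1 := length_formulaGates_le (Fin.castAdd φ.clauses.length) φ.clauses φ.numVars le_rfl
  have h2 := φ.numVars_le
  have h3 : (ofFormula φ p).size = φ.numVars + φ.clauses.length + 1 +
    ((formulaGates (Fin.castAdd φ.clauses.length) φ.clauses φ.numVars le_rfl).length + 8 * p) := by
    simp [size, ofFormula]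
  rw [tCount_ofFormula, CNF3.numClauses, h3]
  omega

theorem pAcc_ofFormula_eq_zero (φ : CNF3) (p : ℕ) (h : ¬ 0 < φ.count) :
    (ofFormula φ p).pAcc = 0 := by
  rw [CNF3.count_pos_iff, not_exists] at h
  rw [pAcc_ofFormula, Finset.sum_eq_zero, zero_div, zero_pow two_ne_zero]
  intro z _
  have hz := h (z ∘ Fin.castAdd φ.clauses.length)
  rw [CNF3.eval, List.all_eq_true] at hz
  push Not at hz
  obtain ⟨c, hc, hcz⟩ := hz
  refine List.prod_eq_zero (List.mem_map.2 ⟨c, hc, clauseWeight_eq_zero c _ ?_⟩)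
  simpa using hcz

/-- All weights are nonnegative, so a single term of the sum suffices: a satisfying assignment,
where each clause contributes at least `2^(-1/2)`. -/
theorem le_pAcc_ofFormula (φ : CNF3) (p : ℕ) (h : 0 < φ.count) :
    ((2 : ℝ) ^ (9 * φ.numClauses))⁻¹ ≤ (ofFormula φ p).pAcc := by
  obtain ⟨x, hx⟩ := φ.count_pos_iff.1 h
  set m := φ.clauses.length with hm
  -- The flag signs do not affect the weights; any choice would do.
  let z : Fin (φ.numVars + m) → Bool := Fin.append x fun _ => false
  have hz : z ∘ Fin.castAdd m = x := by
    ext i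
    simp [z]
  have hprod : (Real.sqrt 2 / 2) ^ m ≤
      (φ.clauses.map fun c => clauseWeight c (z ∘ Fin.castAdd m)).prod := by
    rw [hz, hm]
    rw [CNF3.eval, List.all_eq_true] at hx
    generalize φ.clauses = cs at hx ⊢
    induction cs with
    | nil => simp
    | cons c cs ih =>
      rw [List.map_cons, List.prod_cons, List.length_cons, pow_succ']
      have h1 := le_clauseWeight c x (hx c List.mem_cons_self)
      have h2 := ih fun c hc => hx c (List.mem_cons_of_mem _ hc)
      exact mul_le_mul h1 h2 (by positivity) (clauseWeight_nonneg c x)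
  have hsum : (Real.sqrt 2 / 2) ^ m ≤ ∑ z : Fin (φ.numVars + m) → Bool,
      (φ.clauses.map fun c => clauseWeight c (z ∘ Fin.castAdd m)).prod := by
    refine hprod.trans (Finset.single_le_sum (f := fun z : Fin (φ.numVars + m) → Bool =>
      (φ.clauses.map fun c => clauseWeight c (z ∘ Fin.castAdd m)).prod) (fun z _ => ?_)
        (Finset.mem_univ z))
    refine List.prod_nonneg fun r hr => ?_
    obtain ⟨c, -, rfl⟩ := List.mem_map.1 hr
    exact clauseWeight_nonneg c _
  have hsq : (Real.sqrt 2 / 2) ^ 2 = (2 : ℝ)⁻¹ := by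
    rw [div_pow, Real.sq_sqrt (by norm_num)]
    norm_num
  calc ((2 : ℝ) ^ (9 * φ.numClauses))⁻¹
      -- With `n ≤ 3m` the exponent `m + 2(n + m)` is at most `9m`.
      ≤ ((2 : ℝ) ^ (m + (φ.numVars + m) * 2))⁻¹ := by
        have := φ.numVars_le
        refine inv_anti₀ (by positivity) (pow_le_pow_right₀ (by norm_num) ?_)
        rw [CNF3.numClauses]
        omega
    _ = ((Real.sqrt 2 / 2) ^ m / 2 ^ (φ.numVars + m)) ^ 2 := by
        rw [div_pow, ← pow_mul, mul_comm m 2, pow_mul, hsq, ← pow_mul, pow_add, mul_inv, inv_pow,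
          div_eq_mul_inv]
    _ ≤ _ := by
        rw [pAcc_ofFormula]
        gcongr

end CTCircuit

/-! ### Time-bounded runs and growth of the stacks -/

namespace Turing.TM2

variable {K : Type*} [DecidableEq K] {Γ : K → Type*} {Λ σ : Type*}

/-- The program `M` gets from one configuration to another in at most `T` steps. -/
def Within (M : Λ → Stmt Γ Λ σ) (T : ℕ) (c c' : Cfg Γ Λ σ) : Prop :=
  ∃ k ≤ T, (Bind.bind · (step M))^[k] (some c) = some c'

namespace Within

variable {M : Λ → Stmt Γ Λ σ} {T T' : ℕ} {c c' c'' : Cfg Γ Λ σ}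

theorem refl (M : Λ → Stmt Γ Λ σ) (T : ℕ) (c : Cfg Γ Λ σ) : Within M T c c := ⟨0, Nat.zero_le _, rfl⟩

theorem mono (h : Within M T c c') (hT : T ≤ T') : Within M T' c c' :=
  let ⟨k, hk, h⟩ := h
  ⟨k, hk.trans hT, h⟩

theorem trans (h : Within M T c c') (h' : Within M T' c' c'') : Within M (T + T') c c'' := by
  obtain ⟨k, hk, h⟩ := h
  obtain ⟨k', hk', h'⟩ := h'
  exact ⟨k' + k, by omega, by rw [Function.iterate_add_apply, h, h']⟩

theorem step {l : Λ} {v : σ} {S : ∀ k, List (Γ k)}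
    (h : Within M T (stepAux (M l) v S) c') : Within M (T + 1) ⟨some l, v, S⟩ c' := by
  obtain ⟨k, hk, h⟩ := h
  exact ⟨k + 1, by omega, by rw [Function.iterate_succ_apply]; exact h⟩

end Within

/-- The largest number of symbols that a statement pushes. -/
def Stmt.pushes : Stmt Γ Λ σ → ℕ
  | .push _ _ q => q.pushes + 1
  | .peek _ _ q => q.pushes
  | .pop _ _ q => q.pushes
  | .load _ q => q.pushes
  | .branch _ q₁ q₂ => max q₁.pushes q₂.pushes
  | .goto _ => 0
  | .halt => 0

theorem length_stepAux_le (q : Stmt Γ Λ σ) (v : σ) (S : ∀ k, List (Γ k)) (k : K) :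
    ((stepAux q v S).stk k).length ≤ (S k).length + q.pushes := by
  induction q generalizing v S with
  | push k' f q ih =>
    have h := ih v (Function.update S k' (f v :: S k'))
    simp only [stepAux, Stmt.pushes]
    by_cases hk : k = k'
    · subst hk
      simp only [Function.update_self, List.length_cons] at h
      omega
    · rw [Function.update_of_ne hk] at h
      omega
  | peek k' f q ih => exact ih _ _
  | pop k' f q ih =>
    have h := ih (f v (S k').head?) (Function.update S k' (S k').tail)
    simp only [stepAux, Stmt.pushes]
    by_cases hk : k = k'
    · subst hk
      simp only [Function.update_self, List.length_tail] at h
      omega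
    · rw [Function.update_of_ne hk] at h
      omega
  | load f q ih => exact ih _ _
  | branch f q₁ q₂ ih₁ ih₂ =>
    simp only [stepAux, Stmt.pushes]
    cases f v
    · exact (ih₂ v S).trans (by simp)
    · exact (ih₁ v S).trans (by simp)
  | goto f => simp [stepAux]
  | halt => simp [stepAux]

/-- There are finitely many labels, so the number of pushes per step is bounded. This bounds the
length of the output of `A`, and hence the time needed to read it. -/
theorem exists_length_le [Fintype Λ] (M : Λ → Stmt Γ Λ σ) :
    ∃ C, ∀ (j : ℕ) (c c' : Cfg Γ Λ σ), (Bind.bind · (step M))^[j] (some c) = some c' →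
      ∀ k, (c'.stk k).length ≤ (c.stk k).length + C * j := by
  refine ⟨Finset.univ.sup fun l => (M l).pushes, fun j => ?_⟩
  induction j with
  | zero =>
    rintro c c' h k
    obtain rfl : c = c' := by simpa using h
    simp
  | succ j ih =>
    rintro ⟨l, v, S⟩ c' h k
    rw [Function.iterate_succ_apply] at h
    cases l with
    -- A halted configuration has no successor, so no further step can lead to `c'`.
    | none =>
      have (j : ℕ) : (Bind.bind · (step M))^[j] none = none := by
        induction j with
        | zero => rfl
        | succ j ih => rw [Function.iterate_succ_apply]; exact ih
      have h' : (Bind.bind · (step M))^[j] none = some c' := h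
      rw [this] at h'
      cases h'
    | some l =>
      have h1 := ih (stepAux (M l) v S) c' h k
      have h2 := length_stepAux_le (M l) v S k
      have h3 : (M l).pushes ≤ Finset.univ.sup fun l => (M l).pushes :=
        Finset.le_sup (f := fun l => (M l).pushes) (Finset.mem_univ l)
      rw [mul_add, mul_one]
      dsimp only
      omega

end Turing.TM2

instance : Fintype CNF3.Symbol := ⟨{.tick, .pos, .neg}, fun x => by cases x <;> simp⟩

instance : Fintype CTGate.Symbol :=
  ⟨{.tick, .sep, .h, .s, .t, .cz}, fun x => by cases x <;> simp⟩

/-! ### The machine deciding satisfiability -/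

namespace SatMachine

/-- Unary counters. -/
inductive Counter
  | flag
  | lit
  | tmp
  | thr
  deriving DecidableEq

instance : Fintype Counter := ⟨{.flag, .lit, .tmp, .thr}, fun x => by cases x <;> simp⟩

/-- The stacks besides those of the simulated machine. -/
inductive Stack
  | inp
  | out
  | ans
  | counter (a : Counter)
  deriving DecidableEq, Fintype

/-- The alphabets of the stacks. -/
def Stack.Alphabet : Stack → Type
  | inp => CNF3.Symbol
  | out => CTGate.Symbol
  | ans => Bool
  | counter _ => Unit

/-- The labels besides those of the simulated machine. -/
inductive Label
  | readVars
  | readLit (i : Fin 3) (neg : Bool)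
  | emitLit (i : Fin 3) (neg : Bool) (j : Fin 6)
  | emitFlag (j : Fin 4)
  | unload
  | unloadFlag
  | readFirst
  | readNum
  | readDen
  | clearOut
  | clearThr (b : Bool)
  deriving Fintype

/-- The internal state: the state of the simulated machine and the results of the last pops. -/
structure Var (σ : Type) where
  /-- state of the simulated machine -/
  sim : σ
  /-- symbol of the formula -/
  next : Option CNF3.Symbol
  /-- symbol of the circuit -/
  sym : Option CTGate.Symbol
  /-- symbol of the output of the simulated machine -/
  digit : Option (Option Bool)
  /-- whether a counter was positive -/
  pos : Bool
  deriving Fintype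

variable (A : TM2ComputableAux CTGate.Symbol (Option Bool)) (p : ℕ)

/-- The alphabets of all the stacks. -/
def Alphabet : A.tm.K ⊕ Stack → Type := Sum.elim A.tm.Γ Stack.Alphabet

/-- The statements of the machine. -/
abbrev Statement : Type := TM2.Stmt (Alphabet A) (A.tm.Λ ⊕ Label) (Var A.tm.σ)

/-- The configurations of the machine. -/
abbrev Config : Type := TM2.Cfg (Alphabet A) (A.tm.Λ ⊕ Label) (Var A.tm.σ)

variable {A}

/-- The simulation of a statement. -/
def embed : TM2.Stmt A.tm.Γ A.tm.Λ A.tm.σ → Statement A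
  | .push k f q => .push (.inl k) (fun v => f v.sim) (embed q)
  | .peek k f q => .peek (.inl k) (fun v x => { v with sim := f v.sim x }) (embed q)
  | .pop k f q => .pop (.inl k) (fun v x => { v with sim := f v.sim x }) (embed q)
  | .load f q => .load (fun v => { v with sim := f v.sim }) (embed q)
  | .branch f q₁ q₂ => .branch (fun v => f v.sim) (embed q₁) (embed q₂)
  | .goto f => .goto fun v => .inl (f v.sim)
  | .halt => .goto fun _ => .inr .readFirst

/-- Jump to a label. -/
def jump (l : Label) : Statement A := .goto fun _ => .inr l

/-- Write a word. -/
def write (w : List CTGate.Symbol) (q : Statement A) : Statement A :=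
  w.foldr (fun x q => .push (.inr .out) (fun _ => x) q) q

/-- Increase a counter. -/
def increase (a : Counter) (k : ℕ) (q : Statement A) : Statement A :=
  (TM2.Stmt.push (.inr (.counter a)) fun _ => ())^[k] q

/-- Decrease a counter and branch on whether it was positive. -/
def decrease (a : Counter) (q₁ q₂ : Statement A) : Statement A :=
  .pop (.inr (.counter a)) (fun v x => { v with pos := x.isSome }) (.branch (·.pos) q₁ q₂)

/-- Read a symbol of the formula. -/
def popInp (q : Statement A) : Statement A :=
  .pop (.inr .inp) (fun v (x : Option CNF3.Symbol) => { v with next := x }) q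

/-- Remove the last symbol of the circuit. -/
def popOut (q : Statement A) : Statement A :=
  .pop (.inr .out) (fun v (x : Option CTGate.Symbol) => { v with sym := x }) q

/-- Give a symbol to the simulated machine. -/
def pushInput (f : Var A.tm.σ → CTGate.Symbol) (q : Statement A) : Statement A :=
  .push (.inl A.tm.k₀) (fun v => A.inputAlphabet.symm (f v)) q

/-- Read a symbol of the output of the simulated machine. -/
def popDigit (q : Statement A) : Statement A :=
  .pop (.inl A.tm.k₁)
    (fun v (x : Option (A.tm.Γ A.tm.k₁)) => { v with digit := x.map A.outputAlphabet }) q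

/-- Erase the internal state and halt with the answer `b`. -/
def answer (b : Bool) : Statement A :=
  .push (.inr .ans) (fun _ => b) <|
    .load (fun _ => ⟨A.tm.initialState, none, none, none, false⟩) .halt

/-- The loop at the label `self` that moves a counter, writing a tick each time if `emit`. -/
def transfer (src : Counter) (dst : Option Counter) (emit : Bool) (self : Label)
    (done : Statement A) : Statement A :=
  decrease src (dst.elim id (increase · 1) (write (if emit then [.tick] else []) (jump self))) done

/-- Begin the next clause, or finish the circuit if there is none. -/
def beginClause : Statement A :=
  .branch (·.next.isSome)
    (write [.h, .t] (increase .lit 1 (.goto fun v => .inr (.readLit 0 (v.next = some .neg)))))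
    (write (List.replicate (8 * p) .t) (increase .thr 1 (jump .unload)))

/-- What to do after a literal. -/
def afterLiteral (i : Fin 3) : Statement A :=
  if i = 2 then write [.h, .h] (jump (.emitFlag 0))
  else increase .lit 1 (.goto fun v => .inr (.readLit (i + 1) (v.next = some .neg)))

variable (A)

/-- The program at the labels besides those of the simulated machine. -/
def program : Label → Statement A
  | .readVars => popInp <|
      .branch (fun v => v.next = some .tick) (increase .flag 1 (jump .readVars))
        (increase .flag 1 (beginClause p))
  | .readLit i neg => popInp <|
      .branch (fun v => v.next = some .tick) (increase .lit 1 (jump (.readLit i neg)))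
        (write [.h, .h] (jump (.emitLit i neg 0)))
  | .emitLit i neg 0 =>
      transfer .lit (some .tmp) true (.emitLit i neg 0) (write [.cz] (jump (.emitLit i neg 1)))
  | .emitLit i neg 1 =>
      transfer .tmp (some .lit) true (.emitLit i neg 1) (write [.sep, .h] (jump (.emitLit i neg 2)))
  | .emitLit i neg 2 =>
      transfer .lit (some .tmp) true (.emitLit i neg 2)
        (write ([.h] ++ List.replicate 9 .t ++ List.replicate (if neg then 3 else 0) .s ++ [.h, .h])
          (jump (.emitLit i neg 3)))
  | .emitLit i neg 3 =>
      transfer .tmp (some .lit) true (.emitLit i neg 3) (write [.cz] (jump (.emitLit i neg 4)))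
  | .emitLit i neg 4 =>
      transfer .lit (some .tmp) true (.emitLit i neg 4) (write [.sep, .h] (jump (.emitLit i neg 5)))
  | .emitLit i neg 5 =>
      transfer .tmp none true (.emitLit i neg 5) (write [.h] (afterLiteral i))
  | .emitFlag 0 =>
      transfer .flag (some .tmp) true (.emitFlag 0) (write [.cz] (jump (.emitFlag 1)))
  | .emitFlag 1 =>
      transfer .tmp (some .flag) true (.emitFlag 1) (write [.sep, .h] (jump (.emitFlag 2)))
  | .emitFlag 2 =>
      transfer .flag (some .tmp) true (.emitFlag 2) (jump (.emitFlag 3))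
  | .emitFlag 3 =>
      transfer .tmp (some .flag) false (.emitFlag 3)
        (increase .flag 1 (increase .thr 9 (beginClause p)))
  | .unload => popOut <|
      .branch (·.sym.isSome)
        (pushInput (·.sym.getD .tick) (jump .unload))
        (jump .unloadFlag)
  | .unloadFlag => decrease .flag
      (pushInput (fun _ => .tick) (jump .unloadFlag))
      (.goto fun _ => .inl A.tm.main)
  | .readFirst => popDigit <|
      .branch (·.digit.join.isSome) (increase .thr 1 (jump .readNum)) (jump .clearOut)
  | .readNum => popDigit <|
      .branch (·.digit.join.isSome) (increase .thr 1 (jump .readNum)) (jump .readDen)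
  | .readDen => popDigit <|
      .branch (·.digit.isSome) (decrease .thr (jump .readDen) (jump .clearOut))
        (jump (.clearThr true))
  | .clearOut => popDigit <|
      .branch (·.digit.isSome) (jump .clearOut) (jump (.clearThr false))
  | .clearThr b => decrease .thr (jump (.clearThr b)) (answer b)

/-- The program of the whole machine. -/
def fullProgram : A.tm.Λ ⊕ Label → Statement A
  | .inl l => embed (A.tm.m l)
  | .inr l => program A p l

/-- The machine that writes the circuit of a formula, runs `A` on it, and compares the lengths of
the numerator and the denominator that `A` outputs. -/
def machine : TM2ComputableAux CNF3.Symbol Bool where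
  tm :=
    { K := A.tm.K ⊕ Stack
      kDecidableEq := inferInstance
      kFin := @instFintypeSum _ _ A.tm.kFin _
      k₀ := .inr .inp
      k₁ := .inr .ans
      Γ := Alphabet A
      Λ := A.tm.Λ ⊕ Label
      main := .inr .readVars
      ΛFin := @instFintypeSum _ _ A.tm.ΛFin _
      σ := Var A.tm.σ
      initialState := ⟨A.tm.initialState, none, none, none, false⟩
      σFin := @instFintypeVar _ A.tm.σFin
      Γk₀Fin := inferInstanceAs (Fintype CNF3.Symbol)
      m := fullProgram A p }
  inputAlphabet := Equiv.refl _
  outputAlphabet := Equiv.refl _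

variable {A}

/-! ### Effect of single statements on the stacks -/

/-- The contents of the counters. -/
def counts (c l t h : ℕ) : Counter → ℕ
  | .flag => c
  | .lit => l
  | .tmp => t
  | .thr => h

/-- The contents of the stacks; the word `out` is written on its stack from the bottom to the
top. -/
def store (S : ∀ k, List (A.tm.Γ k)) (inp : List CNF3.Symbol) (out : List CTGate.Symbol)
    (ans : List Bool) (n : Counter → ℕ) : ∀ k, List (Alphabet A k)
  | .inl k => S k
  | .inr .inp => inp
  | .inr .out => out.reverse
  | .inr .ans => ans
  | .inr (.counter a) => List.replicate (n a) ()

section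

variable (c l t h x : ℕ)

@[simp] theorem counts_flag : counts c l t h .flag = c := rfl
@[simp] theorem counts_lit : counts c l t h .lit = l := rfl
@[simp] theorem counts_tmp : counts c l t h .tmp = t := rfl
@[simp] theorem counts_thr : counts c l t h .thr = h := rfl

@[simp] theorem update_counts_flag :
    Function.update (counts c l t h) .flag x = counts x l t h := by
  ext a; cases a <;> rfl
@[simp] theorem update_counts_lit :
    Function.update (counts c l t h) .lit x = counts c x t h := by
  ext a; cases a <;> rfl
@[simp] theorem update_counts_tmp :
    Function.update (counts c l t h) .tmp x = counts c l x h := by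
  ext a; cases a <;> rfl
@[simp] theorem update_counts_thr :
    Function.update (counts c l t h) .thr x = counts c l t x := by
  ext a; cases a <;> rfl

end

section

variable (S : ∀ k, List (A.tm.Γ k)) (inp : List CNF3.Symbol) (out : List CTGate.Symbol)
  (ans : List Bool) (n : Counter → ℕ)

@[simp] theorem update_store_inl (k : A.tm.K) (x : List (A.tm.Γ k)) :
    Function.update (store S inp out ans n) (.inl k) x =
      store (Function.update S k x) inp out ans n := by
  funext k'
  rcases k' with k' | k'
  · by_cases h : k' = k
    · subst h
      exact (Function.update_self (β := fun k => List (Alphabet A k)) _ _ _).trans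
        (Function.update_self (β := fun k => List (A.tm.Γ k)) k' x S).symm
    · exact (Function.update_of_ne (β := fun k => List (Alphabet A k))
        (fun h' => h (Sum.inl_injective h')) _ _).trans (Function.update_of_ne h _ _).symm
  · refine (Function.update_of_ne (β := fun k => List (Alphabet A k))
      Sum.inr_ne_inl _ _).trans ?_
    cases k' <;> rfl

theorem update_store_inp (x : List CNF3.Symbol) :
    Function.update (store S inp out ans n) (.inr .inp) x = store S x out ans n := by
  funext k
  rcases k with k | k | k | k | k <;> rfl

theorem update_store_out (x : List CTGate.Symbol) :
    Function.update (store S inp out ans n) (.inr .out) x = store S inp x.reverse ans n := by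
  funext k
  rcases k with k | k | k | k | k
  iterate 2 rfl
  · exact (List.reverse_reverse x).symm
  iterate 2 rfl

theorem update_store_ans (x : List Bool) :
    Function.update (store S inp out ans n) (.inr .ans) x = store S inp out x n := by
  funext k
  rcases k with k | k | k | k | k <;> rfl

theorem update_store_counter (a : Counter) (x : ℕ) :
    Function.update (store S inp out ans n) (.inr (.counter a)) (List.replicate x ()) =
      store S inp out ans (Function.update n a x) := by
  funext k
  rcases k with k | k | k | k | k
  iterate 4 rfl
  by_cases h : k = a
  · subst h
    refine (Function.update_self (β := fun k => List (Alphabet A k)) _ _ _).trans ?_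
    exact congrArg (List.replicate · ()) (Function.update_self k x n).symm
  · refine (Function.update_of_ne (β := fun k => List (Alphabet A k))
      (fun h' => h (by simpa using h')) _ _).trans ?_
    exact congrArg (List.replicate · ()) (Function.update_of_ne h x n).symm

variable (v : Var A.tm.σ) (q q₁ q₂ : Statement A)

@[simp] theorem stepAux_jump (l : Label) (T : ∀ k, List (Alphabet A k)) :
    TM2.stepAux (jump l) v T = ⟨some (.inr l), v, T⟩ := rfl

@[simp] theorem stepAux_write (w : List CTGate.Symbol) :
    TM2.stepAux (write w q) v (store S inp out ans n) =
      TM2.stepAux q v (store S inp (out ++ w) ans n) := by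
  induction w generalizing out with
  | nil =>
    rw [List.append_nil]
    rfl
  | cons x w ih =>
    have h : (store S inp out ans n) (.inr .out) = out.reverse := rfl
    change TM2.stepAux (write w q) v (Function.update _ _ _) = _
    have h1 := update_store_out S inp out ans n (x :: out.reverse)
    have h2 := ih (out ++ [x])
    simp only [List.reverse_cons, List.reverse_reverse, List.append_assoc, List.singleton_append]
      at h1 h2
    rw [← h2, ← h1]
    rfl

@[simp] theorem stepAux_increase (a : Counter) (k : ℕ) :
    TM2.stepAux (increase a k q) v (store S inp out ans n) =
      TM2.stepAux q v (store S inp out ans (Function.update n a (n a + k))) := by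
  induction k generalizing n with
  | zero => simp [increase]
  | succ k ih =>
    have h1 := update_store_counter S inp out ans n a (n a + 1)
    have h2 := ih (Function.update n a (n a + 1))
    rw [Function.update_idem, Function.update_self, add_assoc, add_comm 1 k] at h2
    rw [← h2, ← h1, increase, Function.iterate_succ_apply']
    rfl

theorem stepAux_decrease_zero (a : Counter) (ha : n a = 0) :
    TM2.stepAux (decrease a q₁ q₂) v (store S inp out ans n) =
      TM2.stepAux q₂ { v with pos := false } (store S inp out ans n) := by
  have h1 := update_store_counter S inp out ans n a 0
  rw [← ha, Function.update_eq_self, ha] at h1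
  have h2 : (store S inp out ans n) (.inr (.counter a)) = [] :=
    congrArg (List.replicate · ()) ha
  simp only [decrease, TM2.stepAux, h2]
  exact congrArg (TM2.stepAux q₂ _) h1

theorem stepAux_decrease_succ (a : Counter) (k : ℕ) (ha : n a = k + 1) :
    TM2.stepAux (decrease a q₁ q₂) v (store S inp out ans n) =
      TM2.stepAux q₁ { v with pos := true } (store S inp out ans (Function.update n a k)) := by
  have h1 := update_store_counter S inp out ans n a k
  have h2 : (store S inp out ans n) (.inr (.counter a)) = () :: List.replicate k () :=
    congrArg (List.replicate · ()) ha
  simp only [decrease, TM2.stepAux, h2]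
  exact congrArg (TM2.stepAux q₁ _) h1

theorem stepAux_popInp :
    TM2.stepAux (popInp q) v (store S inp out ans n) =
      TM2.stepAux q { v with next := inp.head? } (store S inp.tail out ans n) :=
  congrArg (TM2.stepAux q _) (update_store_inp S inp out ans n inp.tail)

theorem stepAux_popOut :
    TM2.stepAux (popOut q) v (store S inp out ans n) =
      TM2.stepAux q { v with sym := out.getLast? } (store S inp out.dropLast ans n) := by
  have h := update_store_out S inp out ans n out.reverse.tail
  rw [List.tail_reverse, List.reverse_reverse] at h
  rw [← List.head?_reverse, ← h, ← List.tail_reverse]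
  rfl

theorem stepAux_answer (b : Bool) :
    TM2.stepAux (answer b) v (store S inp out ans n) =
      ⟨none, ⟨A.tm.initialState, none, none, none, false⟩, store S inp out (b :: ans) n⟩ :=
  congrArg (TM2.Cfg.mk _ _) (update_store_ans S inp out ans n (b :: ans))

variable (A) in
/-- The stacks of the simulated machine with the input `w`. -/
def inputStacks (w : List CTGate.Symbol) : ∀ k, List (A.tm.Γ k) :=
  (initList A.tm (w.map A.inputAlphabet.symm)).stk

variable (A) in
/-- The stacks of the simulated machine with the output `w`. -/
def outputStacks (w : List (Option Bool)) : ∀ k, List (A.tm.Γ k) :=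
  (haltList A.tm (w.map A.outputAlphabet.symm)).stk

theorem inputStacks_eq (w : List CTGate.Symbol) :
    inputStacks A w = Function.update (fun _ => []) A.tm.k₀ (w.map A.inputAlphabet.symm) := by
  funext k
  by_cases h : k = A.tm.k₀
  · subst h
    simp [inputStacks, initList]
  · rw [Function.update_of_ne h]
    simp [inputStacks, initList, h]

theorem outputStacks_eq (w : List (Option Bool)) :
    outputStacks A w = Function.update (fun _ => []) A.tm.k₁ (w.map A.outputAlphabet.symm) := by
  funext k
  by_cases h : k = A.tm.k₁
  · subst h
    simp [outputStacks, haltList]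
  · rw [Function.update_of_ne h]
    simp [outputStacks, haltList, h]

theorem update_inputStacks (w w' : List CTGate.Symbol) :
    Function.update (inputStacks A w) A.tm.k₀ (w'.map A.inputAlphabet.symm) =
      inputStacks A w' := by
  rw [inputStacks_eq, inputStacks_eq, Function.update_idem]

theorem stepAux_pushInput (w : List CTGate.Symbol) (f : Var A.tm.σ → CTGate.Symbol) :
    TM2.stepAux (pushInput f q) v (store (inputStacks A w) inp out ans n) =
      TM2.stepAux q v (store (inputStacks A (f v :: w)) inp out ans n) := by
  have h : Function.update (store (inputStacks A w) inp out ans n) (.inl A.tm.k₀)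
      ((f v :: w).map A.inputAlphabet.symm) = store (inputStacks A (f v :: w)) inp out ans n := by
    exact (update_store_inl _ _ _ _ _ _ _).trans
      (congrArg (store · inp out ans n) (update_inputStacks w (f v :: w)))
  have h2 : store (inputStacks A w) inp out ans n (.inl A.tm.k₀) = w.map A.inputAlphabet.symm :=
    (congrFun (inputStacks_eq w) A.tm.k₀).trans (Function.update_self _ _ _)
  simp only [pushInput, TM2.stepAux, h2]
  exact congrArg (TM2.stepAux q v) h

theorem stepAux_popDigit (w : List (Option Bool)) :
    TM2.stepAux (popDigit q) v (store (outputStacks A w) inp out ans n) =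
      TM2.stepAux q { v with digit := w.head? } (store (outputStacks A w.tail) inp out ans n) := by
  have h : Function.update (store (outputStacks A w) inp out ans n) (.inl A.tm.k₁)
      (w.map A.outputAlphabet.symm).tail = store (outputStacks A w.tail) inp out ans n := by
    refine (update_store_inl _ _ _ _ _ _ _).trans ?_
    rw [outputStacks_eq, outputStacks_eq, Function.update_idem, List.map_tail]
  have h2 : store (outputStacks A w) inp out ans n (.inl A.tm.k₁) = w.map A.outputAlphabet.symm :=
    (congrFun (outputStacks_eq w) A.tm.k₁).trans (Function.update_self _ _ _)
  have h3 : (w.map A.outputAlphabet.symm).head?.map A.outputAlphabet = w.head? := by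
    cases w <;> simp
  rw [← h3]
  simp only [popDigit, TM2.stepAux, h2]
  exact congrArg (TM2.stepAux q _) h

/-- The simulation is step for step; the only difference is that halting becomes a jump to the label
that starts reading the output. -/
theorem stepAux_embed (q : TM2.Stmt A.tm.Γ A.tm.Λ A.tm.σ) :
    TM2.stepAux (embed q) v (store S inp out ans n) =
      ⟨some ((TM2.stepAux q v.sim S).l.elim (.inr .readFirst) .inl),
        { v with sim := (TM2.stepAux q v.sim S).var },
        store (TM2.stepAux q v.sim S).stk inp out ans n⟩ := by
  induction q generalizing v S with
  | push k f q ih =>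
    rw [TM2.stepAux, ← ih _ v, ← update_store_inl]
    rfl
  | peek k f q ih => exact ih S { v with sim := f v.sim (S k).head? }
  | pop k f q ih =>
    rw [TM2.stepAux, ← ih _ { v with sim := f v.sim (S k).head? }, ← update_store_inl]
    rfl
  | load f q ih => exact ih S { v with sim := f v.sim }
  | branch f q₁ q₂ ih₁ ih₂ =>
    simp only [embed, TM2.stepAux]
    cases f v.sim
    · exact ih₂ S v
    · exact ih₁ S v
  | goto f => rfl
  | halt => rfl

end

end SatMachine

/-! ### Writing the circuit -/

namespace SatMachine

variable {A : TM2ComputableAux CTGate.Symbol (Option Bool)} {p : ℕ}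

open TM2 (Within)

section

variable {S : ∀ k, List (A.tm.Γ k)} {inp : List CNF3.Symbol} {out : List CTGate.Symbol}
  {ans : List Bool} {n : Counter → ℕ} {v : Var A.tm.σ} {T : ℕ} {c' : Config A}

/-- Reading a unary counter destroys it, so its value is moved to another counter while the ticks
are written. Each unit costs one step, and one more step detects that the counter is empty. -/
theorem within_transfer {src : Counter} {dst : Option Counter} {emit : Bool} {self : Label}
    {done : Statement A} (hM : program A p self = transfer src dst emit self done)
    (hdst : dst ≠ some src) (k : ℕ) (hk : n src = k)
    (H : Within (fullProgram A p) T (TM2.stepAux done { v with pos := false }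
      (store S inp (out ++ List.replicate (if emit then k else 0) .tick) ans
        (Function.update (dst.elim n fun d => Function.update n d (n d + k)) src 0))) c') :
    Within (fullProgram A p) (T + (k + 1)) ⟨some (.inr self), v, store S inp out ans n⟩ c' := by
  induction k generalizing n out v with
  | zero =>
    refine Within.step ?_
    rw [fullProgram, hM, transfer, stepAux_decrease_zero _ _ _ _ _ _ _ _ _ hk]
    convert H using 3
    · cases emit <;> simp
    · funext a
      by_cases ha : a = src
      · subst ha
        simpa using hk
      · cases dst <;> simp [ha]
  | succ k ih =>
    refine Within.step ?_
    rw [fullProgram, hM, transfer, stepAux_decrease_succ _ _ _ _ _ _ _ _ _ k hk]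
    cases dst with
    | none =>
      simp only [Option.elim_none, id, stepAux_write, stepAux_jump]
      refine ih (Function.update_self _ _ _) ?_
      convert H using 3
      · cases emit <;> simp [List.replicate_succ]
      · simp
    | some d =>
      have hd : d ≠ src := fun h => hdst (congrArg some h)
      simp only [Option.elim_some, stepAux_increase, stepAux_write, stepAux_jump]
      refine ih ?_ ?_
      · simp [hd.symm]
      convert H using 3
      · cases emit <;> simp [List.replicate_succ]
      · funext a
        by_cases ha : a = src
        · simp [ha]
        · by_cases had : a = d
          · subst had
            simp [ha]
            ring
          · simp [ha, had]

end

section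

variable {S : ∀ k, List (A.tm.Γ k)} {inp : List CNF3.Symbol} {out : List CTGate.Symbol}
  {ans : List Bool} {v : Var A.tm.σ} {T : ℕ} {c' : Config A} {c l t h : ℕ}

/-- The description of `coupling`, for the qubit with index `i`. -/
def couplingText (i : ℕ) : List CTGate.Symbol :=
  .h :: (List.replicate i .tick ++ .cz :: (List.replicate i .tick ++ .sep :: .h ::
    List.replicate i .tick))

/-- The description of `literalGates`, for the qubit with index `i`. -/
def literalText (neg : Bool) (i : ℕ) : List CTGate.Symbol :=
  .h :: (couplingText i ++ [.h] ++ List.replicate 9 .t ++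
    List.replicate (if neg then 3 else 0) .s ++ [.h] ++ couplingText i ++ [.h])

theorem within_emitLit (i : Fin 3) (neg : Bool)
    (H : Within (fullProgram A p) T (TM2.stepAux (afterLiteral i) { v with pos := false }
      (store S inp (out ++ literalText neg l) ans (counts c 0 0 h))) c') :
    Within (fullProgram A p) (T + 6 * (l + 1)) ⟨some (.inr (.emitLit i neg 0)), v,
      store S inp (out ++ [.h, .h]) ans (counts c l 0 h)⟩ c' := by
  rw [show T + 6 * (l + 1) = T + (l + 1) + (l + 1) + (l + 1) + (l + 1) + (l + 1) + (l + 1) by ring]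
  -- The qubit index occurs six times, three times in each coupling. The value shuttles between
  -- `lit` and `tmp`, and the last pass discards it.
  iterate 6
    refine within_transfer rfl (by decide) l rfl ?_
    simp only [Option.elim_none, Option.elim_some, stepAux_write, stepAux_jump,
      update_counts_lit, update_counts_tmp, counts_lit, counts_tmp, zero_add]
  simpa [literalText, couplingText] using H

theorem within_emitFlag
    (H : Within (fullProgram A p) T (TM2.stepAux (beginClause p) { v with pos := false }
      (store S inp (out ++ .h :: couplingText c) ans (counts (c + 1) 0 0 (h + 9)))) c') :
    Within (fullProgram A p) (T + 4 * (c + 1)) ⟨some (.inr (.emitFlag 0)), v,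
      store S inp (out ++ [.h, .h]) ans (counts c 0 0 h)⟩ c' := by
  rw [show T + 4 * (c + 1) = T + (c + 1) + (c + 1) + (c + 1) + (c + 1) by ring]
  -- Three passes write the index; the fourth writes nothing and restores `flag`, which is still
  -- needed.
  iterate 4
    refine within_transfer rfl (by decide) c rfl ?_
    simp only [Option.elim_some, stepAux_write, stepAux_jump, stepAux_increase,
      update_counts_flag, update_counts_tmp, update_counts_thr, counts_thr, counts_flag,
      counts_tmp, zero_add]
  simpa [couplingText] using H

/-- The end of a unary index is noticed only by popping the symbol after it. That symbol, the sign
of the next literal if there is one, is kept in `next`; hence the continuation starts from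
`inp.tail`. -/
theorem within_readLit (i : Fin 3) (neg : Bool) (k : ℕ) (hinp : inp.head? ≠ some .tick)
    (H : Within (fullProgram A p) T
      (TM2.stepAux (afterLiteral i) { v with next := inp.head?, pos := false }
        (store S inp.tail (out ++ literalText neg (l + k)) ans (counts c 0 0 h))) c') :
    Within (fullProgram A p) (T + 6 * (l + k + 1) + (k + 1)) ⟨some (.inr (.readLit i neg)), v,
      store S (List.replicate k .tick ++ inp) out ans (counts c l 0 h)⟩ c' := by
  induction k generalizing l v with
  | zero =>
    refine Within.step ?_
    rw [fullProgram, program, stepAux_popInp]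
    simp only [TM2.stepAux, List.replicate_zero, List.nil_append, hinp, decide_false, cond_false,
      stepAux_write, stepAux_jump]
    exact within_emitLit i neg H
  | succ k ih =>
    rw [show T + 6 * (l + (k + 1) + 1) + (k + 1 + 1) = T + 6 * (l + 1 + k + 1) + (k + 1) + 1 by
      ring]
    refine Within.step ?_
    rw [fullProgram, program, stepAux_popInp]
    simp only [TM2.stepAux, List.replicate_succ, List.cons_append, List.head?_cons, decide_true,
      cond_true, stepAux_increase, stepAux_jump, List.tail_cons, counts_lit, update_counts_lit]
    refine ih ?_
    rwa [add_assoc, add_comm 1 k]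

/-- The description of `clauseGates`, with the variables shifted by one and with the flag on the
qubit with index `f`. -/
def clauseText {n : ℕ} (c : Literal n × Literal n × Literal n) (f : ℕ) : List CTGate.Symbol :=
  [.h, .t] ++ literalText (!c.1.2) (c.1.1 + 1) ++ literalText (!c.2.1.2) (c.2.1.1 + 1) ++
    literalText (!c.2.2.2) (c.2.2.1 + 1) ++ .h :: couplingText f

/-- The description of a clause. -/
def encodeClause {n : ℕ} (c : Literal n × Literal n × Literal n) : List CNF3.Symbol :=
  CNF3.encodeLit c.1 ++ CNF3.encodeLit c.2.1 ++ CNF3.encodeLit c.2.2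

theorem head?_encodeLit_append {n : ℕ} (l : Literal n) (w : List CNF3.Symbol) :
    (CNF3.encodeLit l ++ w).head? = some (if l.2 then .pos else .neg) := rfl

theorem head?_encodeLit_append_ne {n : ℕ} (l : Literal n) (w : List CNF3.Symbol) :
    (CNF3.encodeLit l ++ w).head? ≠ some .tick := by
  rw [head?_encodeLit_append]
  split_ifs <;> simp

theorem tail_encodeLit_append {n : ℕ} (l : Literal n) (w : List CNF3.Symbol) :
    (CNF3.encodeLit l ++ w).tail = List.replicate l.1 .tick ++ w := rfl

theorem decide_sign_eq_neg (b : Bool) :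
    decide (some (if b then CNF3.Symbol.pos else CNF3.Symbol.neg) = some .neg) = !b := by
  cases b <;> rfl

theorem within_clause {n N : ℕ} (cl : Literal n × Literal n × Literal n) (hn : n ≤ N) (hc : c ≤ N)
    (hinp : inp.head? ≠ some .tick)
    (H : Within (fullProgram A p) T
      (TM2.stepAux (beginClause p) { v with next := inp.head?, pos := false }
        (store S inp.tail (out ++ clauseText cl c) ans (counts (c + 1) 0 0 (h + 9)))) c') :
    ∀ b, Within (fullProgram A p) (T + 25 * (N + 2))
      (TM2.stepAux (beginClause p) { v with next := (encodeClause cl ++ inp).head?, pos := b }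
        (store S (encodeClause cl ++ inp).tail out ans (counts c 0 0 h))) c' := by
  intro b
  obtain ⟨l₁, l₂, l₃⟩ := cl
  have h₁ := l₁.1.isLt
  have h₂ := l₂.1.isLt
  have h₃ := l₃.1.isLt
  simp only [encodeClause, List.append_assoc, head?_encodeLit_append, tail_encodeLit_append]
  simp only [beginClause, TM2.stepAux, Option.isSome_some, cond_true, stepAux_write,
    stepAux_increase, counts_lit, update_counts_lit, zero_add]
  rw [decide_sign_eq_neg]
  -- The counter `lit` starts at `1` because variable `i` lives on qubit `i + 1`.
  refine Within.mono (T := T + 4 * (c + 1) + 6 * (1 + l₃.1 + 1) + (l₃.1 + 1) +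
    6 * (1 + l₂.1 + 1) + (l₂.1 + 1) + 6 * (1 + l₁.1 + 1) + (l₁.1 + 1)) ?_ (by omega)
  refine within_readLit _ _ _ (head?_encodeLit_append_ne _ _) ?_
  simp only [afterLiteral, show (0 : Fin 3) ≠ 2 by decide, if_false, TM2.stepAux, stepAux_increase,
    counts_lit, update_counts_lit, zero_add, tail_encodeLit_append, head?_encodeLit_append,
    decide_sign_eq_neg]
  refine within_readLit _ _ _ (head?_encodeLit_append_ne _ _) ?_
  simp only [afterLiteral, show (1 : Fin 3) ≠ 2 by decide, if_false, TM2.stepAux, stepAux_increase,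
    counts_lit, update_counts_lit, zero_add, tail_encodeLit_append, head?_encodeLit_append,
    decide_sign_eq_neg]
  refine within_readLit _ _ _ hinp ?_
  simp only [afterLiteral, show (1 + 1 : Fin 3) = 2 by decide, if_true, stepAux_write, stepAux_jump]
  refine within_emitFlag ?_
  simpa [clauseText, add_comm] using H

/-- The description of `formulaGates`. -/
def formulaText {n : ℕ} : List (Literal n × Literal n × Literal n) → ℕ → List CTGate.Symbol
  | [], _ => []
  | c :: cs, k => clauseText c k ++ formulaText cs (k + 1)

/-- Per clause `flag` grows by `1` and `thr` by `9`; the final unit of `thr` comes from leaving the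
loop. The value left in `pos` depends on whether there was a clause and is irrelevant, so `H` allows
both. -/
theorem within_clauses {n N : ℕ} (cs : List (Literal n × Literal n × Literal n)) (hn : n ≤ N)
    (hc : c + cs.length ≤ N) (b : Bool)
    (H : ∀ b, Within (fullProgram A p) T
      ⟨some (.inr .unload), { v with next := none, pos := b },
        store S [] (out ++ formulaText cs c ++ List.replicate (8 * p) .t) ans
          (counts (c + cs.length) 0 0 (h + 9 * cs.length + 1))⟩ c') :
    Within (fullProgram A p) (T + 25 * (N + 2) * cs.length)
      (TM2.stepAux (beginClause p) { v with next := (cs.flatMap encodeClause).head?, pos := b }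
        (store S (cs.flatMap encodeClause).tail out ans (counts c 0 0 h))) c' := by
  induction cs generalizing c h out b with
  | nil =>
    simpa [beginClause, TM2.stepAux, formulaText] using H b
  | cons cl cs ih =>
    rw [List.flatMap_cons]
    simp only [List.length_cons] at hc ⊢
    rw [mul_add, mul_one, ← add_assoc]
    refine within_clause cl hn (by omega) ?_ (ih (c := c + 1) (h := h + 9) (by omega) false ?_) b
    · cases cs with
      | nil => simp
      | cons cl' cs =>
        rw [List.flatMap_cons, encodeClause, List.append_assoc, List.append_assoc]
        exact head?_encodeLit_append_ne _ _
    · intro b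
      convert H b using 3
      · simp [formulaText]
      · congr 1 <;> simp <;> ring

end

end SatMachine

/-! ### The written text is the description of the circuit -/

namespace CTCircuit

theorem encode_coupling {M : ℕ} (j : Fin M) :
    (coupling j).flatMap CTGate.encode = SatMachine.couplingText (j + 1) := by
  simp [coupling, CTGate.encode, SatMachine.couplingText]

theorem encode_literalGates {M : ℕ} (neg : Bool) (j : Fin M) :
    (literalGates neg j).flatMap CTGate.encode = SatMachine.literalText neg (j + 1) := by
  cases neg <;>
    simp [literalGates, List.flatMap_append, encode_coupling, CTGate.encode,
      SatMachine.literalText, List.replicate_succ]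

theorem encode_formulaGates {M n : ℕ} (e : Fin n → Fin M) (he : ∀ i, (e i).val = i.val)
    (cs : List (Literal n × Literal n × Literal n)) (k : ℕ) (hk : k + cs.length ≤ M) :
    (formulaGates e cs k hk).flatMap CTGate.encode = SatMachine.formulaText cs (k + 1) := by
  induction cs generalizing k with
  | nil => rfl
  | cons c cs ih =>
    simp only [formulaGates, clauseGates, List.flatMap_append, encode_coupling,
      encode_literalGates, ih, he, SatMachine.formulaText, SatMachine.clauseText]
    simp [CTGate.encode]

/-- The description of the gates of `ofFormula φ p`. -/
def gateText (φ : CNF3) (p : ℕ) : List CTGate.Symbol :=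
  SatMachine.formulaText φ.clauses (φ.numVars + 1) ++ List.replicate (8 * p) .t

theorem encode_ofFormula (φ : CNF3) (p : ℕ) :
    (ofFormula φ p).encode =
      List.replicate (φ.numVars + φ.numClauses + 1) .tick ++ gateText φ p := by
  have h : (List.replicate (8 * p) (CTGate.T (0 : Fin (φ.numVars + φ.clauses.length + 1)))).flatMap
      CTGate.encode = List.replicate (8 * p) .t := by
    induction 8 * p with
    | zero => rfl
    | succ k ih => simp only [List.replicate_succ, List.flatMap_cons, ih]; simp [CTGate.encode]
  rw [gateText, ← h, ← encode_formulaGates (Fin.castAdd φ.clauses.length) (fun _ => rfl) φ.clauses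
    φ.numVars le_rfl, ← List.flatMap_append]
  rfl

theorem length_encode_le (V : CTCircuit) :
    V.encode.length ≤ V.numQubits + V.gates.length * (2 * V.numQubits + 2) := by
  rw [encode, List.length_append, List.length_replicate]
  refine Nat.add_le_add_left ?_ _
  induction V.gates with
  | nil => simp
  | cons g gs ih =>
    have hg : g.encode.length ≤ 2 * V.numQubits + 2 := by
      cases g <;> simp [CTGate.encode] <;> omega
    rw [List.flatMap_cons, List.length_append, List.length_cons, add_mul, one_mul]
    omega

theorem length_encode_ofFormula_le (φ : CNF3) (p : ℕ) :
    (ofFormula φ p).encode.length ≤ (72 * φ.numClauses + 8 * p + 1) * (8 * φ.numClauses + 4) := by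
  have h1 := length_encode_le (ofFormula φ p)
  have h2 := length_formulaGates_le (Fin.castAdd φ.clauses.length) φ.clauses φ.numVars le_rfl
  have h3 : (ofFormula φ p).numQubits ≤ 4 * φ.numClauses + 1 := by
    have := φ.numVars_le
    change φ.numVars + φ.clauses.length + 1 ≤ 4 * φ.clauses.length + 1
    omega
  have h4 : (ofFormula φ p).gates.length ≤ 72 * φ.numClauses + 8 * p := by
    simp only [ofFormula, List.length_append, List.length_replicate, CNF3.numClauses]
    omega
  calc _ ≤ _ := h1
    _ ≤ (8 * φ.numClauses + 4) +
        (72 * φ.numClauses + 8 * p) * (8 * φ.numClauses + 4) := by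
      refine add_le_add (by omega) (Nat.mul_le_mul h4 (by omega))
    _ = _ := by ring

end CTCircuit

/-! ### Simulating the algorithm and reading its output -/

namespace SatMachine

variable {A : TM2ComputableAux CTGate.Symbol (Option Bool)} {p : ℕ}

open TM2 (Within)

section

variable {S : ∀ k, List (A.tm.Γ k)} {inp : List CNF3.Symbol} {out w : List CTGate.Symbol}
  {ans : List Bool} {n : Counter → ℕ} {v : Var A.tm.σ} {T : ℕ} {c' : Config A} {c l t h : ℕ}

theorem within_readVars (k : ℕ) (hinp : inp.head? ≠ some .tick)
    (H : Within (fullProgram A p) T (TM2.stepAux (beginClause p) { v with next := inp.head? }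
      (store S inp.tail out ans (counts (c + k + 1) 0 0 h))) c') :
    Within (fullProgram A p) (T + (k + 1)) ⟨some (.inr .readVars), v,
      store S (List.replicate k .tick ++ inp) out ans (counts c 0 0 h)⟩ c' := by
  induction k generalizing c v with
  | zero =>
    refine Within.step ?_
    rw [fullProgram, program, stepAux_popInp]
    simpa only [TM2.stepAux, List.replicate_zero, List.nil_append, hinp, decide_false, cond_false,
      stepAux_increase, counts_flag, update_counts_flag] using H
  | succ k ih =>
    refine Within.step ?_
    rw [fullProgram, program, stepAux_popInp]
    simp only [TM2.stepAux, List.replicate_succ, List.cons_append, List.head?_cons, decide_true,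
      cond_true, stepAux_increase, stepAux_jump, List.tail_cons, counts_flag, update_counts_flag]
    refine ih ?_
    rwa [add_assoc c, add_comm 1 k]

/-- The top of the stack `out` is the last symbol of the circuit, so moving it symbol by symbol
leaves the first symbol on top of the input stack. -/
theorem within_unload
    (H : Within (fullProgram A p) T ⟨some (.inr .unloadFlag), { v with sym := none },
      store (inputStacks A (out ++ w)) inp [] ans n⟩ c') :
    Within (fullProgram A p) (T + (out.length + 1)) ⟨some (.inr .unload), v,
      store (inputStacks A w) inp out ans n⟩ c' := by
  induction out using List.reverseRecOn generalizing w v with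
  | nil =>
    refine Within.step ?_
    rw [fullProgram, program, stepAux_popOut]
    exact H
  | append_singleton out x ih =>
    rw [List.length_append, List.length_singleton]
    refine Within.step ?_
    rw [fullProgram, program, stepAux_popOut]
    simp only [TM2.stepAux, List.getLast?_concat, Option.isSome_some, cond_true,
      List.dropLast_concat, stepAux_pushInput, stepAux_jump, Option.getD_some]
    refine ih ?_
    simpa using H

theorem within_unloadFlag
    (H : Within (fullProgram A p) T ⟨some (.inl A.tm.main), { v with pos := false },
      store (inputStacks A (List.replicate c .tick ++ w)) inp out ans (counts 0 l t h)⟩ c') :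
    Within (fullProgram A p) (T + (c + 1)) ⟨some (.inr .unloadFlag), v,
      store (inputStacks A w) inp out ans (counts c l t h)⟩ c' := by
  induction c generalizing w v with
  | zero =>
    refine Within.step ?_
    rw [fullProgram, program, stepAux_decrease_zero _ _ _ _ _ _ _ _ _ rfl]
    exact H
  | succ c ih =>
    refine Within.step ?_
    rw [fullProgram, program, stepAux_decrease_succ _ _ _ _ _ _ _ _ _ c rfl]
    simp only [stepAux_pushInput, stepAux_jump, update_counts_flag]
    refine ih ?_
    rw [List.append_cons, ← List.replicate_succ']
    exact H

theorem within_simulation {k : ℕ} {c₀ c₁ : TM2.Cfg A.tm.Γ A.tm.Λ A.tm.σ}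
    (hk : (Bind.bind · (TM2.step A.tm.m))^[k] (some c₀) = some c₁) (hv : v.sim = c₀.var) :
    Within (fullProgram A p) k
      ⟨some (c₀.l.elim (.inr .readFirst) .inl), v, store c₀.stk inp out ans n⟩
      ⟨some (c₁.l.elim (.inr .readFirst) .inl), { v with sim := c₁.var },
        store c₁.stk inp out ans n⟩ := by
  induction k generalizing c₀ v with
  | zero =>
    obtain rfl : c₀ = c₁ := by simpa using hk
    rw [← hv]
    exact Within.refl _ _ _
  | succ k ih =>
    rw [Function.iterate_succ_apply] at hk
    obtain ⟨l, var, S⟩ := c₀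
    cases l with
    | none =>
      have (j : ℕ) : (Bind.bind · (TM2.step A.tm.m))^[j] none = none := by
        induction j with
        | zero => rfl
        | succ j ih => rw [Function.iterate_succ_apply]; exact ih
      exact absurd ((this k).symm.trans hk) (by simp)
    | some l =>
      refine Within.step ?_
      simp only [Option.elim_some, fullProgram]
      rw [stepAux_embed, hv]
      exact ih (v := { v with sim := (TM2.stepAux (A.tm.m l) var S).var }) hk rfl

end

section

variable {v : Var A.tm.σ} {h : ℕ}

variable (A) in
/-- The configuration in which the machine has halted with the answer `b`. -/
def halted (b : Bool) : Config A :=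
  ⟨none, ⟨A.tm.initialState, none, none, none, false⟩,
    store (outputStacks A []) [] [] [b] (counts 0 0 0 0)⟩

theorem within_clearThr (b : Bool) :
    Within (fullProgram A p) (h + 1) ⟨some (.inr (.clearThr b)), v,
      store (outputStacks A []) [] [] [] (counts 0 0 0 h)⟩ (halted A b) := by
  induction h generalizing v with
  | zero =>
    refine Within.step ?_
    rw [fullProgram, program, stepAux_decrease_zero _ _ _ _ _ _ _ _ _ rfl, stepAux_answer]
    exact Within.refl _ _ _
  | succ h ih =>
    refine Within.step ?_
    rw [fullProgram, program, stepAux_decrease_succ _ _ _ _ _ _ _ _ _ h rfl, update_counts_thr]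
    exact ih

theorem within_clearOut (w : List (Option Bool)) :
    Within (fullProgram A p) (w.length + h + 2) ⟨some (.inr .clearOut), v,
      store (outputStacks A w) [] [] [] (counts 0 0 0 h)⟩ (halted A false) := by
  induction w generalizing v with
  | nil =>
    refine (Within.step (T := h + 1) ?_).mono (by simp)
    rw [fullProgram, program, stepAux_popDigit]
    exact within_clearThr false
  | cons x w ih =>
    refine (Within.step (T := w.length + h + 2) ?_).mono (by simp only [List.length_cons]; omega)
    rw [fullProgram, program, stepAux_popDigit]
    exact ih

/-- Each digit of the denominator uses up one unit of `thr`; running out means that the denominator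
is too long. Both outcomes still empty the output stack and the counter, as the halting
configuration requires. -/
theorem within_readDen (w : List Bool) :
    Within (fullProgram A p) (w.length + h + 2) ⟨some (.inr .readDen), v,
      store (outputStacks A (w.map some)) [] [] [] (counts 0 0 0 h)⟩
      (halted A (w.length ≤ h)) := by
  induction w generalizing v h with
  | nil =>
    refine (Within.step (T := h + 1) ?_).mono (by simp)
    rw [fullProgram, program, stepAux_popDigit]
    exact within_clearThr true
  | cons x w ih =>
    cases h with
    | zero =>
      refine (Within.step (T := (w.map some).length + 0 + 2) ?_).mono (by simp)
      rw [fullProgram, program, stepAux_popDigit]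
      simp only [TM2.stepAux, List.map_cons, List.head?_cons, Option.isSome_some, cond_true,
        List.tail_cons, List.length_cons, Nat.le_zero, Nat.succ_ne_zero, decide_false]
      rw [stepAux_decrease_zero _ _ _ _ _ _ _ _ _ rfl, stepAux_jump]
      exact within_clearOut (h := 0) (w.map some)
    | succ h =>
      refine (Within.step (T := w.length + h + 2) ?_).mono (by simp; omega)
      rw [fullProgram, program, stepAux_popDigit]
      simp only [TM2.stepAux, List.map_cons, List.head?_cons, Option.isSome_some, cond_true,
        List.tail_cons, List.length_cons, Nat.add_le_add_iff_right]
      rw [stepAux_decrease_succ _ _ _ _ _ _ _ _ _ h rfl, update_counts_thr]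
      exact ih

theorem within_readNum (w w' : List Bool) :
    Within (fullProgram A p) (2 * w.length + w'.length + h + 3) ⟨some (.inr .readNum), v,
      store (outputStacks A (w.map some ++ none :: w'.map some)) [] [] [] (counts 0 0 0 h)⟩
      (halted A (w'.length ≤ h + w.length)) := by
  induction w generalizing v h with
  | nil =>
    refine (Within.step (T := w'.length + h + 2) ?_).mono (by simp)
    rw [fullProgram, program, stepAux_popDigit]
    exact within_readDen w'
  | cons x w ih =>
    refine (Within.step (T := 2 * w.length + w'.length + (h + 1) + 3) ?_).mono (by simp; omega)
    rw [fullProgram, program, stepAux_popDigit]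
    simp only [TM2.stepAux, List.map_cons, List.cons_append, List.head?_cons, List.tail_cons,
      Option.join_some, Option.isSome_some, cond_true, stepAux_increase, counts_thr,
      update_counts_thr, stepAux_jump, List.length_cons]
    simp only [show h + (w.length + 1) = h + 1 + w.length by omega]
    exact ih

/-- Binary digits without superfluous zeros make the number of digits equal to `Nat.size`, so `a =
0` shows up as an empty numerator, and the comparison needs only counting. -/
theorem within_readFirst (a b : ℕ) :
    Within (fullProgram A p) (2 * (encodeFraction a b).length + h + 3)
      ⟨some (.inr .readFirst), v,
        store (outputStacks A (encodeFraction a b)) [] [] [] (counts 0 0 0 h)⟩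
      (halted A (a ≠ 0 ∧ b.size ≤ h + a.size)) := by
  rw [encodeFraction, ← Nat.size_eq_bits_len, ← Nat.size_eq_bits_len]
  have ha : a = 0 ↔ a.bits = [] := by
    rw [← List.length_eq_zero_iff, Nat.size_eq_bits_len, Nat.size_eq_zero]
  rw [show (decide (a ≠ 0 ∧ b.bits.length ≤ h + a.bits.length)) =
    decide (a.bits ≠ [] ∧ b.bits.length ≤ h + a.bits.length) by simp only [ne_eq, ha]]
  generalize a.bits = w
  generalize b.bits = w'
  cases w with
  | nil =>
    refine (Within.step (T := (w'.map some).length + h + 2) ?_).mono (by simp; omega)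
    rw [fullProgram, program, stepAux_popDigit]
    simpa using within_clearOut (w'.map some)
  | cons x w =>
    refine (Within.step (T := 2 * w.length + w'.length + (h + 1) + 3) ?_).mono (by simp; omega)
    rw [fullProgram, program, stepAux_popDigit]
    simp only [TM2.stepAux, List.map_cons, List.cons_append, List.head?_cons, List.tail_cons,
      Option.join_some, Option.isSome_some, cond_true, stepAux_increase, counts_thr,
      update_counts_thr, stepAux_jump, List.length_cons]
    simp only [show h + (w.length + 1) = h + 1 + w.length by omega]
    simpa using within_readNum (h := h + 1) w w'

end

theorem encode_eq (φ : CNF3) : φ.encode =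
    List.replicate φ.numVars .tick ++ φ.clauses.flatMap encodeClause := rfl

variable (A) in
/-- The initial configuration. -/
def initial (w : List CNF3.Symbol) : Config A :=
  ⟨some (.inr .readVars), ⟨A.tm.initialState, none, none, none, false⟩,
    store (inputStacks A []) w [] [] (counts 0 0 0 0)⟩

theorem within_initial (φ : CNF3) {k a b : ℕ}
    (hk : (Bind.bind · (TM2.step A.tm.m))^[k]
      (some (initList A.tm ((CTCircuit.ofFormula φ p).encode.map A.inputAlphabet.symm))) =
      some (haltList A.tm ((encodeFraction a b).map A.outputAlphabet.symm))) :
    Within (fullProgram A p) (2 * (encodeFraction a b).length + k +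
        (CTCircuit.ofFormula φ p).encode.length + 25 * (4 * φ.numClauses + 3) * φ.numClauses +
        12 * φ.numClauses + 7)
      (initial A φ.encode) (halted A (a ≠ 0 ∧ b.size ≤ 9 * φ.numClauses + 1 + a.size)) := by
  have hn := φ.numVars_le
  set m := φ.clauses.length with hm
  have hm' : φ.numClauses = m := rfl
  have hlen : (CTCircuit.ofFormula φ p).encode.length =
      φ.numVars + m + 1 + (CTCircuit.gateText φ p).length := by
    rw [CTCircuit.encode_ofFormula, List.length_append, List.length_replicate, hm']
  rw [hlen, hm']
  refine Within.mono (T := 2 * (encodeFraction a b).length + (9 * m + 1) + 3 + k +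
    (φ.numVars + m + 1 + 1) + ((CTCircuit.gateText φ p).length + 1) +
    25 * (4 * m + 3) * m + (φ.numVars + 1)) ?_ (by omega)
  rw [encode_eq, initial]
  refine within_readVars _ ?_ ?_
  · cases φ.clauses with
    | nil => simp
    | cons c cs =>
      rw [List.flatMap_cons, encodeClause, List.append_assoc, List.append_assoc]
      exact head?_encodeLit_append_ne _ _
  -- The counter `flag` starts at `n + 1`, the qubit of the first flag, and ends at `n + m + 1 ≤ 4m
  -- + 1`.
  refine within_clauses (N := 4 * m + 1) φ.clauses (by omega) (by omega) false fun b' => ?_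
  simp only [List.nil_append, zero_add]
  refine within_unload (out := CTCircuit.gateText φ p) ?_
  rw [List.append_nil, show φ.numVars + 1 + φ.clauses.length = φ.numVars + m + 1 by omega]
  -- The final value of `flag` is the number of qubits, so emptying it supplies the unary prefix of
  -- the description.
  refine within_unloadFlag ?_
  rw [← hm', ← CTCircuit.encode_ofFormula]
  rw [add_comm _ k]
  refine (within_simulation hk rfl).trans ?_
  exact within_readFirst (h := 9 * φ.numClauses + 1) a b

theorem initial_eq (w : List CNF3.Symbol) : initial A w =
    initList (machine A p).tm (w.map (machine A p).inputAlphabet.symm) := by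
  refine congrArg (TM2.Cfg.mk _ _) ?_
  funext k
  rcases k with k | k | k | k | k
  · have h : inputStacks A [] k = [] := by
      rw [inputStacks_eq]
      exact congrFun (Function.update_eq_self A.tm.k₀ (fun k => ([] : List (A.tm.Γ k)))) k
    exact h
  · exact (List.map_id w).symm
  iterate 2 rfl
  cases k <;> rfl

theorem halted_eq (b : Bool) : halted A b =
    haltList (machine A p).tm ([b].map (machine A p).outputAlphabet.symm) := by
  refine congrArg (TM2.Cfg.mk _ _) ?_
  funext k
  rcases k with k | k | k | k | k
  · have h : outputStacks A [] k = [] := by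
      rw [outputStacks_eq]
      exact congrFun (Function.update_eq_self A.tm.k₁ (fun k => ([] : List (A.tm.Γ k)))) k
    exact h
  iterate 3 rfl
  cases k <;> rfl

theorem outputsWithin_machine {w : List CNF3.Symbol} {b : Bool} {T : ℕ} {r : ℝ}
    (h : Within (fullProgram A p) T (initial A w) (halted A b)) (hr : (T : ℝ) ≤ r) :
    OutputsWithin (machine A p) w [b] r := by
  obtain ⟨k, hk, h⟩ := h
  refine ⟨T, hr, ⟨⟨⟨k, ?_⟩, hk⟩⟩⟩
  rw [initial_eq (p := p), halted_eq (p := p)] at h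
  exact h

theorem exists_length_encodeFraction_le (A : TM2ComputableAux CTGate.Symbol (Option Bool)) :
    ∃ C, ∀ (w : List CTGate.Symbol) (a b k : ℕ), (Bind.bind · (TM2.step A.tm.m))^[k]
      (some (initList A.tm (w.map A.inputAlphabet.symm))) =
      some (haltList A.tm ((encodeFraction a b).map A.outputAlphabet.symm)) →
      (encodeFraction a b).length ≤ w.length + C * k := by
  let _ := A.tm.ΛFin
  obtain ⟨C, hC⟩ := TM2.exists_length_le A.tm.m
  refine ⟨C, fun w a b k hk => ?_⟩
  have h := hC k _ _ hk A.tm.k₁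
  have h1 : ((haltList A.tm ((encodeFraction a b).map A.outputAlphabet.symm)).stk A.tm.k₁) =
      (encodeFraction a b).map A.outputAlphabet.symm := by simp [haltList]
  -- The output stack of `A` may coincide with its input stack, so it need not be empty at the
  -- start.
  have h2 : ((initList A.tm (w.map A.inputAlphabet.symm)).stk A.tm.k₁).length ≤ w.length := by
    change (inputStacks A w A.tm.k₁).length ≤ _
    rw [inputStacks_eq]
    by_cases hk : A.tm.k₁ = A.tm.k₀
    · rw [hk, Function.update_self, List.length_map]
    · rw [Function.update_of_ne hk]
      simp
  rw [h1, List.length_map] at h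
  exact h.trans (Nat.add_le_add_right h2 _)

end SatMachine

/-! ### Deciding from lengths, and asymptotic comparison -/

/-- A satisfiable formula forces `a/b > 2^(-(9m+1))`, an unsatisfiable one `a/b < 2^(-(12m+2))`.
Passing from numbers to their lengths loses at most a factor `2`, which the distance between the two
bounds covers even for `m = 0`. -/
theorem satAnswer_eq_of_abs_pAcc_sub_lt (φ : CNF3) {p a b : ℕ} (hb : 0 < b)
    (h : |(CTCircuit.ofFormula φ p).pAcc - (a : ℝ) / (b : ℝ)| < (2 : ℝ) ^
      (-((3 * ((28 * φ.numClauses + 8 * p : ℕ) : ℝ) + 14) / 7))) :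
    satAnswer φ = [decide (a ≠ 0 ∧ b.size ≤ 9 * φ.numClauses + 1 + a.size)] := by
  set m := φ.numClauses with hm
  have hb' : (0 : ℝ) < b := Nat.cast_pos.2 hb
  -- At `t = 28m + 8p` the exponent is `12m + 2 + 24p/7`.
  have hε : (2 : ℝ) ^ (-((3 * ((28 * m + 8 * p : ℕ) : ℝ) + 14) / 7)) ≤
      ((2 : ℝ) ^ (12 * m + 2))⁻¹ := by
    rw [← Real.rpow_natCast, ← Real.rpow_neg (by norm_num)]
    refine Real.rpow_le_rpow_of_exponent_le (by norm_num) ?_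
    push_cast
    have : (0 : ℝ) ≤ p := Nat.cast_nonneg p
    linarith
  rw [abs_lt] at h
  refine congrArg (fun b => [b]) (decide_eq_decide.2 ?_)
  by_cases hφ : 0 < φ.count
  · refine iff_of_true hφ ?_
    have h1 := CTCircuit.le_pAcc_ofFormula φ p hφ
    have h2 : ((2 : ℝ) ^ (9 * m + 1))⁻¹ < a / b := by
      have h3 : ((2 : ℝ) ^ (12 * m + 2))⁻¹ ≤ ((2 : ℝ) ^ (9 * m + 1))⁻¹ :=
        inv_anti₀ (by positivity) (pow_le_pow_right₀ (by norm_num) (by omega))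
      have h4 : ((2 : ℝ) ^ (9 * m + 1))⁻¹ * 2 = ((2 : ℝ) ^ (9 * m))⁻¹ := by
        rw [pow_succ, mul_inv]
        ring
      linarith [h.2]
    rw [inv_eq_one_div, div_lt_div_iff₀ (by positivity) hb', one_mul] at h2
    have h3 : b < a * 2 ^ (9 * m + 1) := by exact_mod_cast h2
    refine ⟨?_, ?_⟩
    · rintro rfl
      simp at h3
    · rw [Nat.size_le]
      calc b < a * 2 ^ (9 * m + 1) := h3
        _ ≤ 2 ^ a.size * 2 ^ (9 * m + 1) := Nat.mul_le_mul_right _ (Nat.lt_size_self a).le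
        _ = 2 ^ (9 * m + 1 + a.size) := by rw [← pow_add, add_comm]
  · refine iff_of_false hφ ?_
    rintro ⟨ha, hsize⟩
    rw [CTCircuit.pAcc_ofFormula_eq_zero φ p hφ] at h
    have h2 : (a : ℝ) / b < ((2 : ℝ) ^ (12 * m + 2))⁻¹ := by linarith [h.1]
    rw [inv_eq_one_div, div_lt_div_iff₀ hb' (by positivity), one_mul] at h2
    have h3 : a * 2 ^ (12 * m + 2) < b := by exact_mod_cast h2
    have hpos : 0 < a.size := Nat.size_pos.2 (Nat.pos_of_ne_zero ha)
    have h4 : 2 ^ (a.size - 1) ≤ a := Nat.lt_size.1 (by omega)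
    have h5 : 2 ^ (a.size - 1 + (12 * m + 2)) < 2 ^ b.size := by
      rw [pow_add]
      exact ((Nat.mul_le_mul_right _ h4).trans_lt h3).trans (Nat.lt_size_self b)
    have h6 := (Nat.pow_lt_pow_iff_right (by norm_num)).1 h5
    omega

theorem eventually_mul_rpow_le {g : ℕ → ℝ} (hg : g =o[atTop] (fun t : ℕ => (t : ℝ))) (p : ℕ)
    {C c : ℝ} (hC : 0 ≤ C) (hc : 0 < c) :
    ∀ᶠ m : ℕ in atTop, C * (2 : ℝ) ^ g (28 * m + 8 * p) ≤ (2 : ℝ) ^ (c * (m : ℝ)) / 2 := by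
  have ht : Tendsto (fun m : ℕ => 28 * m + 8 * p) atTop atTop :=
    tendsto_atTop_mono (fun m => by simp only [id]; omega) tendsto_id
  -- As `28 * (c / 56) = c / 2`, half of the exponent `c m` is left over to absorb `C` and the
  -- contribution of the padding.
  have h1 := ht.eventually (hg.bound (show 0 < c / 56 by positivity))
  have h2 : Tendsto (fun m : ℕ => (2 : ℝ) ^ (c / 2 * (m : ℝ))) atTop atTop :=
    (tendsto_rpow_atTop_of_base_gt_one 2 (by norm_num)).comp
      (tendsto_natCast_atTop_atTop.const_mul_atTop (by positivity))
  filter_upwards [h1, h2.eventually_ge_atTop (2 * C * (2 : ℝ) ^ (c / 56 * (8 * p)))] with m h1 h2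
  have h3 : g (28 * m + 8 * p) ≤ c / 2 * m + c / 56 * (8 * p) := by
    refine (le_abs_self _).trans ((Real.norm_eq_abs _ ▸ h1).trans (le_of_eq ?_))
    rw [Real.norm_of_nonneg (Nat.cast_nonneg _)]
    push_cast
    ring
  calc C * (2 : ℝ) ^ g (28 * m + 8 * p)
      ≤ C * (2 : ℝ) ^ (c / 2 * m + c / 56 * (8 * p)) := by
        gcongr
        norm_num
    _ = 2 * C * (2 : ℝ) ^ (c / 56 * (8 * p)) * (2 : ℝ) ^ (c / 2 * (m : ℝ)) / 2 := by
        rw [Real.rpow_add (by norm_num)]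
        ring
    _ ≤ (2 : ℝ) ^ (c / 2 * (m : ℝ)) * (2 : ℝ) ^ (c / 2 * (m : ℝ)) / 2 := by gcongr
    _ = (2 : ℝ) ^ (c * (m : ℝ)) / 2 := by
        rw [← Real.rpow_add (by norm_num)]
        ring_nf

theorem eventually_mul_sq_le (D : ℝ) {c : ℝ} (hc : 0 < c) :
    ∀ᶠ m : ℕ in atTop, D * ((m : ℝ) + 1) ^ 2 ≤ (2 : ℝ) ^ (c * (m : ℝ)) / 2 := by
  have hr : 1 < (2 : ℝ) ^ c := Real.one_lt_rpow (by norm_num) hc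
  have h := (isLittleO_pow_const_const_pow_of_one_lt (R := ℝ) 2 hr).bound
    (show 0 < 1 / (8 * (|D| + 1)) by positivity)
  filter_upwards [h, eventually_ge_atTop 1] with m hm h1
  have h1' : (1 : ℝ) ≤ m := by exact_mod_cast h1
  rw [Real.norm_of_nonneg (by positivity), Real.norm_of_nonneg (by positivity),
    ← Real.rpow_mul_natCast (by norm_num), one_div, ← div_eq_inv_mul,
    le_div_iff₀ (by positivity)] at hm
  calc D * ((m : ℝ) + 1) ^ 2 ≤ (|D| + 1) * (2 * (m : ℝ)) ^ 2 := by
        have := le_abs_self D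
        gcongr <;> linarith
    _ ≤ _ := by linarith

theorem theorem6 (hETH : ExponentialTimeHypothesis) :
    ∃ P : Polynomial ℕ,
      ∀ (A : TM2ComputableAux CTGate.Symbol (Option Bool)) (g : ℕ → ℝ),
        g =o[atTop] (fun t : ℕ => (t : ℝ)) →
          {t : ℕ | ∃ V : CTCircuit, V.tCount = t ∧ V.size ≤ P.eval t ∧
            ¬ ComputesPAccWithin A V ((2 : ℝ) ^ g t)
                ((2 : ℝ) ^ (-((3 * (t : ℝ) + 14) / 7)))}.Infinite := by
  refine ⟨3 * Polynomial.X + 1, fun A g hg => ?_⟩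
  by_contra hfin
  rw [Set.not_infinite] at hfin
  -- The bound `p` on the exceptional T-counts fixes the padding: `8 * (p + 1)` further T gates put
  -- every formula above it, so `A` succeeds on all of them, not only on large ones.
  obtain ⟨p, hp⟩ := hfin.bddAbove
  obtain ⟨C, hC⟩ := SatMachine.exists_length_encodeFraction_le A
  have hA (φ : CNF3) : ComputesPAccWithin A (CTCircuit.ofFormula φ (p + 1))
      ((2 : ℝ) ^ g (28 * φ.numClauses + 8 * (p + 1)))
      ((2 : ℝ) ^ (-((3 * ((28 * φ.numClauses + 8 * (p + 1) : ℕ) : ℝ) + 14) / 7))) := by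
    by_contra hφ
    have hle := hp (a := 28 * φ.numClauses + 8 * (p + 1))
      ⟨CTCircuit.ofFormula φ (p + 1), CTCircuit.tCount_ofFormula φ (p + 1), ?_, hφ⟩
    · omega
    · have h := CTCircuit.size_ofFormula_le φ (p + 1)
      rw [CTCircuit.tCount_ofFormula] at h
      simpa using h
  -- A crude constant for the quadratic terms: the descriptions of formula circuits have length
  -- `O(m²)` for fixed `p`.
  let D : ℕ := 100 * (80 * (p + 2)) * 8
  have hB (φ : CNF3) : OutputsWithin (SatMachine.machine A (p + 1)) φ.encode (satAnswer φ)
      (D * ((φ.numClauses : ℝ) + 1) ^ 2 +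
        (2 * C + 1 : ℕ) * (2 : ℝ) ^ g (28 * φ.numClauses + 8 * (p + 1))) := by
    obtain ⟨a, b, hb, ⟨T, hT, ⟨⟨k, hk⟩, hkT⟩⟩, happrox⟩ := hA φ
    have hkT' : k ≤ T := hkT
    rw [satAnswer_eq_of_abs_pAcc_sub_lt φ hb happrox]
    refine SatMachine.outputsWithin_machine (SatMachine.within_initial φ hk) ?_
    have hlen := hC _ a b k hk
    have hE := CTCircuit.length_encode_ofFormula_le φ (p + 1)
    generalize (CTCircuit.ofFormula φ (p + 1)).encode.length = E at *
    generalize (encodeFraction a b).length = L at *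
    generalize φ.numClauses = m at *
    have hpoly : 3 * E + 25 * (4 * m + 3) * m + 12 * m + 7 ≤ D * (m + 1) ^ 2 := by
      have h1 : (72 * m + 8 * (p + 1) + 1) * (8 * m + 4) ≤
          (80 * (p + 2) * (m + 1)) * (8 * (m + 1)) :=
        Nat.mul_le_mul (by ring_nf; omega) (by omega)
      have h2 : 25 * (4 * m + 3) * m + 12 * m + 7 ≤ 100 * (m + 1) ^ 2 := by nlinarith
      have h3 : 100 * (m + 1) ^ 2 ≤ 97 * ((80 * (p + 2) * (m + 1)) * (8 * (m + 1))) := by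
        calc 100 * (m + 1) ^ 2 ≤ (62080 * (p + 2)) * (m + 1) ^ 2 :=
              Nat.mul_le_mul_right _ (by omega)
          _ = 97 * ((80 * (p + 2) * (m + 1)) * (8 * (m + 1))) := by ring
      calc 3 * E + 25 * (4 * m + 3) * m + 12 * m + 7
          ≤ 100 * ((80 * (p + 2) * (m + 1)) * (8 * (m + 1))) := by omega
        _ = 100 * (80 * (p + 2)) * 8 * (m + 1) ^ 2 := by ring
    -- With `L ≤ E + C k` the output length is charged to the circuit length and to the running time
    -- of `A`, giving `3E` and `(2C + 1) k`.
    have hnat : 2 * L + k + E + 25 * (4 * m + 3) * m + 12 * m + 7 ≤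
        D * (m + 1) ^ 2 + (2 * C + 1) * T := by
      have : (2 * C + 1) * k ≤ (2 * C + 1) * T := Nat.mul_le_mul_left _ hkT'
      nlinarith
    calc ((2 * L + k + E + 25 * (4 * m + 3) * m + 12 * m + 7 : ℕ) : ℝ)
        ≤ ((D * (m + 1) ^ 2 + (2 * C + 1) * T : ℕ) : ℝ) := by exact_mod_cast hnat
      _ = D * ((m : ℝ) + 1) ^ 2 + (2 * C + 1 : ℕ) * T := by push_cast; ring
      _ ≤ _ := by gcongr
  obtain ⟨c, hc, hfreq⟩ := hETH (SatMachine.machine A (p + 1)) fun φ => ⟨_, hB φ⟩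
  refine hfreq ?_
  -- Each of the two terms of the running time is eventually at most half of `2^(cm)`.
  filter_upwards [eventually_mul_sq_le D hc,
    eventually_mul_rpow_le hg (p + 1) (Nat.cast_nonneg (2 * C + 1)) hc] with m h1 h2
  rintro ⟨φ, rfl, hφ⟩
  obtain ⟨T, hT, h⟩ := hB φ
  exact hφ ⟨T, hT.trans (by linarith), h⟩
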